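/- For a permutation $\pi$ of $\{1,\dots,n\}$ let $G_\pi$ be its permutation graph: the vertices are $1,\dots,n$, and $i<j$ are adjacent iff $\pi^{-1}(i)>\pi^{-1}(j)$. Represent $i$ by the input point $(i,\pi^{-1}(i))$; two points are adjacent iff one lies strictly to the left of and strictly above the other. For a finite planar set $S$, the bottom (top) boundary consists of the points of $S$ whose open bottom-right (top-left) quadrant contains no point of $S$; each boundary is ordered from left to right. For $v\in S$ let $\mathsf{Bfirst}(v),\mathsf{Blast}(v)$ (resp. $\mathsf{Tfirst}(v),\mathsf{Tlast}(v)$) be the first and last points of the bottom (resp. top) boundary adjacent to $v$, and let the layer number $L(p)$ of a boundary point $p$ be its graph distance in $S$ to the leftmost point of $S$. The augmented set $S_\pi$ is obtained from the input points as follows. First, for every input point $v=(v_x,v_y)$ on the bottom boundary add $(v_x+\epsilon,v_y-\epsilon)$, and for every input point $v$ on the top boundary add $(v_x-\epsilon,v_y+\epsilon)$. Then, for every input point $v$, add the four points $(v_x-\epsilon,\mathsf{Bfirst}(v)_y-\epsilon)$, $(\mathsf{Blast}(v)_x+\epsilon,v_y+\epsilon)$, $(\mathsf{Tfirst}(v)_x-\epsilon,v_y-\epsilon)$,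 $(v_x+\epsilon,\mathsf{Tlast}(v)_y+\epsilon)$. Points are added one at a time, each with an $\epsilon>0$ smaller than all gaps between coordinates present at that moment. **Lemma.** There are an absolute constant $C$ and a single function $D$ (depending neither on $n$ nor on $\pi$) such that the following holds for every permutation $\pi$ of $\{1,\dots,n\}$ for which $G_\pi$ is connected. The four layer numbers $L(\mathsf{Bfirst}(v)),L(\mathsf{Blast}(v)),L(\mathsf{Tfirst}(v)),L(\mathsf{Tlast}(v))$, taken in $S_\pi$, are at most $n+1$ for every input point $v$. Moreover, one can assign to every input point $v$ two integers $v_{x'},v_{y'}\in[0,Cn]$ and two bits $v_{binf},v_{tinf}\in\{0,1\}$ such that, with $$\ell(v)=\bigl(v_{x'},v_{y'},v_{binf},v_{tinf},L(\mathsf{Bfirst}(v)),L(\mathsf{Blast}(v)),L(\mathsf{Tfirst}(v)),L(\mathsf{Tlast}(v))\bigr),$$ we have $D(\ell(u),\ell(v))=d_{G_\pi}(u,v)$ for all distinct input points $u,v$. -/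

import Mathlib

namespace PermDist

/-- Points of the plane. -/
abbrev Pt : Type := ℚ × ℚ

/-- `InTL p q`: the point `q` lies in the (open) top-left quadrant of `p`. -/
def InTL (p q : Pt) : Prop := q.1 < p.1 ∧ p.2 < q.2

/-- `InBR p q`: the point `q` lies in the (open) bottom-right quadrant of `p`. -/
def InBR (p q : Pt) : Prop := p.1 < q.1 ∧ q.2 < p.2

instance (p q : Pt) : Decidable (InTL p q) := inferInstanceAs (Decidable (_ ∧ _))

instance (p q : Pt) : Decidable (InBR p q) := inferInstanceAs (Decidable (_ ∧ _))

/-- The permutation graph of `π`: the vertices are the elements of the permutation, and two of them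
are adjacent iff they form an inversion, i.e. the smaller element stands at the later position. -/
def permGraph {n : ℕ} (π : Equiv.Perm (Fin n)) : SimpleGraph (Fin n) where
  Adj i j := (i < j ∧ π.symm j < π.symm i) ∨ (j < i ∧ π.symm i < π.symm j)
  symm := ⟨fun _ _ h => h.symm⟩
  loopless := ⟨fun i h => by rcases h with h | h <;> exact lt_irrefl i h.1⟩

/-- The graph of a finite set `S` of points: two points of `S` are adjacent iff one of them is in
the top-left or bottom-right quadrant of the other. (Points outside `S` are isolated vertices, which
does not affect distances between points of `S`.) -/
def ptGraph (S : Finset Pt) : SimpleGraph Pt where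
  Adj p q := p ∈ S ∧ q ∈ S ∧ (InTL p q ∨ InBR p q)
  symm := ⟨fun _ _ h => ⟨h.2.1, h.1, h.2.2.symm⟩⟩
  loopless := ⟨fun p h => by rcases h.2.2 with h | h <;> exact lt_irrefl p.1 h.1⟩

/-- The top boundary of `S`: the points of `S` with empty top-left quadrant. -/
def topBoundary (S : Finset Pt) : Finset Pt := S.filter fun p => ∀ q ∈ S, ¬ InTL p q

/-- The bottom boundary of `S`: the points of `S` with empty bottom-right quadrant. -/
def bottomBoundary (S : Finset Pt) : Finset Pt := S.filter fun p => ∀ q ∈ S, ¬ InBR p q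

/-- The points of the top boundary of `S` that are adjacent to `v`. -/
def topNbrs (S : Finset Pt) (v : Pt) : Finset Pt :=
  (topBoundary S).filter fun p => InTL v p ∨ InBR v p

/-- The points of the bottom boundary of `S` that are adjacent to `v`. -/
def bottomNbrs (S : Finset Pt) (v : Pt) : Finset Pt :=
  (bottomBoundary S).filter fun p => InTL v p ∨ InBR v p

/-- The leftmost point of a nonempty finite set of points with distinct first coordinates. -/
noncomputable def first (T : Finset Pt) : Pt :=
  Classical.epsilon fun p => p ∈ T ∧ ∀ q ∈ T, p.1 ≤ q.1

/-- The rightmost point of a nonempty finite set of points with distinct first coordinates. -/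
noncomputable def last (T : Finset Pt) : Pt :=
  Classical.epsilon fun p => p ∈ T ∧ ∀ q ∈ T, q.1 ≤ p.1

theorem first_spec {T : Finset Pt} (h : T.Nonempty) :
    first T ∈ T ∧ ∀ q ∈ T, (first T).1 ≤ q.1 :=
  Classical.epsilon_spec (p := fun p : Pt => p ∈ T ∧ ∀ q ∈ T, p.1 ≤ q.1)
    (T.exists_min_image Prod.fst h)

theorem last_spec {T : Finset Pt} (h : T.Nonempty) :
    last T ∈ T ∧ ∀ q ∈ T, q.1 ≤ (last T).1 :=
  Classical.epsilon_spec (p := fun p : Pt => p ∈ T ∧ ∀ q ∈ T, q.1 ≤ p.1)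
    (T.exists_max_image Prod.fst h)

/-- First neighbour of `v` on the bottom boundary of `S`. (Points of one boundary are ordered in the
same way by both coordinates.) -/
noncomputable def Bfirst (S : Finset Pt) (v : Pt) : Pt := first (bottomNbrs S v)

/-- Last neighbour of `v` on the bottom boundary of `S`. -/
noncomputable def Blast (S : Finset Pt) (v : Pt) : Pt := last (bottomNbrs S v)

/-- First neighbour of `v` on the top boundary of `S`. -/
noncomputable def Tfirst (S : Finset Pt) (v : Pt) : Pt := first (topNbrs S v)

/-- Last neighbour of `v` on the top boundary of `S`. -/
noncomputable def Tlast (S : Finset Pt) (v : Pt) : Pt := last (topNbrs S v)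

/-- The layer number of a boundary point: its distance from the leftmost point of `S`. -/
noncomputable def layer (S : Finset Pt) (p : Pt) : ℕ := (ptGraph S).dist (first S) p

section Augmentation

variable {n : ℕ} (π : Equiv.Perm (Fin n))

/-- The grid representation: element `i ∈ {1, …, n}` is the point `(i, π⁻¹(i))`. -/
def gridPoint (i : Fin n) : Pt := (((i : ℕ) : ℚ) + 1, ((π.symm i : ℕ) : ℚ) + 1)

/-- The set of input points. -/
def inputPoints : Finset Pt := Finset.univ.image (gridPoint π)

/-- A small number: all coordinates used below have the form `k + a ε + b ε ^ 2` with integers `k`,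
`-3 ≤ a ≤ 3` and `0 ≤ b ≤ n`, so that they are compared lexicographically in `(k, a, b)`. -/
def eps (n : ℕ) : ℚ := 1 / (8 * ((n : ℚ) + 1))

/-- First stage: for each input point on a boundary, a point is added right next to it that takes
it off this boundary. -/
def stageOne : Finset Pt :=
  inputPoints π
    ∪ (bottomBoundary (inputPoints π)).image (fun v => (v.1 + 2 * eps n, v.2 - 2 * eps n))
    ∪ (topBoundary (inputPoints π)).image (fun v => (v.1 - 2 * eps n, v.2 + 2 * eps n))

/-- The four auxiliary points
`(v_x - ε, Bfirst(v)_y - ε)`, `(Blast(v)_x + ε, v_y + ε)`,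
`(Tfirst(v)_x - ε, v_y - ε)`, `(v_x + ε, Tlast(v)_y + ε)` of an input point `v`.
The terms of order `ε ^ 2` separate auxiliary points placed next to the same boundary point. The
resulting order of the coordinates is the one that arises when the points are added one at a time,
in any order of the input points, each with an `ε` smaller than all gaps present, and with the
extreme neighbours taken with respect to the current set. -/
noncomputable def auxPoints (v : Pt) : Finset Pt :=
  {(v.1 - eps n, (Bfirst (stageOne π) v).2 - eps n + v.1 * eps n ^ 2),
   ((Blast (stageOne π) v).1 + eps n + v.2 * eps n ^ 2, v.2 + eps n),
   ((Tfirst (stageOne π) v).1 - eps n + v.2 * eps n ^ 2, v.2 - eps n),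
   (v.1 + eps n, (Tlast (stageOne π) v).2 + eps n + v.1 * eps n ^ 2)}

/-- The set of input points with all added boundary points. -/
noncomputable def augmented : Finset Pt :=
  stageOne π ∪ (inputPoints π).biUnion (auxPoints π)

/-- The layer number of `Bfirst(v)` in the augmented set, for the element `v`. -/
noncomputable def layerBfirst (v : Fin n) : ℕ :=
  layer (augmented π) (Bfirst (augmented π) (gridPoint π v))

/-- The layer number of `Blast(v)` in the augmented set. -/
noncomputable def layerBlast (v : Fin n) : ℕ :=
  layer (augmented π) (Blast (augmented π) (gridPoint π v))

/-- The layer number of `Tfirst(v)` in the augmented set. -/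
noncomputable def layerTfirst (v : Fin n) : ℕ :=
  layer (augmented π) (Tfirst (augmented π) (gridPoint π v))

/-- The layer number of `Tlast(v)` in the augmented set. -/
noncomputable def layerTlast (v : Fin n) : ℕ :=
  layer (augmented π) (Tlast (augmented π) (gridPoint π v))

end Augmentation

/-- The data stored for one input point. -/
structure Label where
  /-- first integer `v_{x'}` -/
  x' : ℕ
  /-- second integer `v_{y'}` -/
  y' : ℕ
  /-- bit `v_{binf}` -/
  binf : Bool
  /-- bit `v_{tinf}` -/
  tinf : Bool
  /-- layer number of the first neighbour on the bottom boundary -/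
  lBfirst : ℕ
  /-- layer number of the last neighbour on the bottom boundary -/
  lBlast : ℕ
  /-- layer number of the first neighbour on the top boundary -/
  lTfirst : ℕ
  /-- layer number of the last neighbour on the top boundary -/
  lTlast : ℕ

theorem bottomNbrs_nonempty {S : Finset Pt} {v q : Pt} (hq : q ∈ S) (h : InBR v q) :
    (bottomNbrs S v).Nonempty := by
  obtain ⟨r, hr, hm⟩ := (S.filter (InBR v)).exists_max_image (fun p => p.1 - p.2)
    ⟨q, Finset.mem_filter.2 ⟨hq, h⟩⟩
  rw [Finset.mem_filter] at hr
  refine ⟨r, Finset.mem_filter.2 ⟨Finset.mem_filter.2 ⟨hr.1, fun s hs hrs => ?_⟩, Or.inr hr.2⟩⟩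
  have := hm s (Finset.mem_filter.2 ⟨hs, hr.2.1.trans hrs.1, hrs.2.trans hr.2.2⟩)
  linarith [hrs.1, hrs.2]

theorem topNbrs_nonempty {S : Finset Pt} {v q : Pt} (hq : q ∈ S) (h : InTL v q) :
    (topNbrs S v).Nonempty := by
  obtain ⟨r, hr, hm⟩ := (S.filter (InTL v)).exists_max_image (fun p => p.2 - p.1)
    ⟨q, Finset.mem_filter.2 ⟨hq, h⟩⟩
  rw [Finset.mem_filter] at hr
  refine ⟨r, Finset.mem_filter.2 ⟨Finset.mem_filter.2 ⟨hr.1, fun s hs hrs => ?_⟩, Or.inl hr.2⟩⟩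
  have := hm s (Finset.mem_filter.2 ⟨hs, hrs.1.trans hr.2.1, hr.2.2.trans hrs.2⟩)
  linarith [hrs.1, hrs.2]

theorem eps_pos (n : ℕ) : 0 < eps n := by unfold eps; positivity

/-- No input point lies on a boundary of the first-stage set. -/
theorem exists_quadrants {n : ℕ} (π : Equiv.Perm (Fin n)) {v : Pt} (hv : v ∈ inputPoints π) :
    (∃ q ∈ stageOne π, InBR v q) ∧ (∃ q ∈ stageOne π, InTL v q) := by
  have he := eps_pos n
  constructor
  · by_cases hb : v ∈ bottomBoundary (inputPoints π)
    · exact ⟨_, Finset.mem_union_left _ (Finset.mem_union_right _ (Finset.mem_image_of_mem _ hb)),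
        by show v.1 < v.1 + _; linarith, by show v.2 - _ < v.2; linarith⟩
    · simp only [bottomBoundary, Finset.mem_filter, not_and, not_forall, not_not] at hb
      obtain ⟨q, hq, h⟩ := hb hv
      exact ⟨q, Finset.mem_union_left _ (Finset.mem_union_left _ hq), h⟩
  · by_cases hb : v ∈ topBoundary (inputPoints π)
    · exact ⟨_, Finset.mem_union_right _ (Finset.mem_image_of_mem _ hb),
        by show v.1 - _ < v.1; linarith, by show v.2 < v.2 + _; linarith⟩
    · simp only [topBoundary, Finset.mem_filter, not_and, not_forall, not_not] at hb
      obtain ⟨q, hq, h⟩ := hb hv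
      exact ⟨q, Finset.mem_union_left _ (Finset.mem_union_left _ hq), h⟩

/-- All extreme boundary neighbours used above exist. -/
theorem nbrs_nonempty {n : ℕ} (π : Equiv.Perm (Fin n)) {v : Pt} (hv : v ∈ inputPoints π) :
    ((bottomNbrs (stageOne π) v).Nonempty ∧ (topNbrs (stageOne π) v).Nonempty) ∧
    (bottomNbrs (augmented π) v).Nonempty ∧ (topNbrs (augmented π) v).Nonempty := by
  obtain ⟨⟨q, hq, h⟩, r, hr, h'⟩ := exists_quadrants π hv
  exact ⟨⟨bottomNbrs_nonempty hq h, topNbrs_nonempty hr h'⟩,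
    bottomNbrs_nonempty (Finset.mem_union_left _ hq) h,
    topNbrs_nonempty (Finset.mem_union_left _ hr) h'⟩

end PermDist

/-! Distances between incomparable-or-not points of a planar set `S` come from a two-coordinate
sweep. Given a threshold in one coordinate, `reach` is the largest other coordinate among the points
strictly below the threshold, and `climb` iterates this, alternating coordinates. If `v` is not
dominated by `u`, the distance from `u` to `v` is `1 + k`, where `k` is the least number of
iterations after which a threshold started at some coordinate of `u` exceeds the corresponding
coordinate of `v` (`dist_eq`). Coordinate indices matter only modulo 2, so there are just two
starts.

Running the same sweep from the leftmost point gives thresholds `front`, which cut the values of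
each coordinate into layers. The layer of the first coordinate of `v` is the layer number of
`Bfirst`, that of the second coordinate is the layer number of `Tfirst` (`IsLeftEnd.isLayer_Bfirst`,
`IsLeftEnd.isLayer_Tfirst`). A climb of `k` steps from layer `m` stays within the fronts `m + k - 2`
and `m + k`, so layers alone decide whether it passes a coordinate of layer `n`, unless `n = m + k`
(`IsLeftEnd.lt_climb_iff`).

The undecided comparisons are all instances of one strict weak order, `Precedes`, because each
`reach` is monotone. Hence a single ranking of the `2 * n` coordinates settles them, and these ranks
are the two stored integers. The bits are constant, and the layers of `Blast` and `Tlast` are not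
needed for the decoder.

This computes distances in the augmented set. They agree with those of the permutation graph,
because rounding an added point to integer coordinates gives a position that input points dominate
towards both boundaries (`dist_augmented`). -/

namespace PermDist

/-! ### Ranking values on different layers along a sequence of monotone maps. -/

section Rank

variable {β : Type*}

/-- The composition of `k` consecutive maps of the sequence `f`, the first one being `f m`. -/
def climb (f : ℕ → β → β) (m : ℕ) : ℕ → β → β
  | 0, x => x
  | k + 1, x => f (m + k) (climb f m k x)

theorem climb_add (f : ℕ → β → β) (m k l : ℕ) (x : β) :
    climb f m (k + l) x = climb f (m + k) l (climb f m k x) := by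
  induction l with
  | zero => rfl
  | succ l ih => rw [← add_assoc, climb, climb, ih, add_assoc]

theorem climb_mono [Preorder β] {f : ℕ → β → β} (hf : ∀ m, Monotone (f m)) (m k : ℕ) :
    Monotone (climb f m k) := by
  induction k with
  | zero => exact monotone_id
  | succ k ih => exact (hf _).comp ih

theorem climb_congr {f : ℕ → β → β} (hf : ∀ m, f (m + 2) = f m) (m k : ℕ) :
    climb f (m + 2) k = climb f m k := by
  induction k with
  | zero => rfl
  | succ k ih =>
    funext x
    rw [climb, climb, ih, show m + 2 + k = m + k + 2 by ring, hf]

theorem climb_climb (f : ℕ → β → β) {i j k : ℕ} (hij : i ≤ j) (hjk : j ≤ k) (x : β) :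
    climb f j (k - j) (climb f i (j - i) x) = climb f i (k - i) x := by
  have h := climb_add f i (j - i) (k - j) x
  rw [show j - i + (k - j) = k - i by omega, show i + (j - i) = j by omega] at h
  exact h.symm

variable [LinearOrder β]

/-- Comparison of two values on possibly different layers: the one on the lower layer is first
transported to the layer of the other one; an equality is decided in favour of the upper layer. -/
def Precedes (f : ℕ → β → β) (a b : ℕ × β) : Prop :=
  (b.1 ≤ a.1 ∧ a.2 < climb f b.1 (a.1 - b.1) b.2) ∨
    (a.1 < b.1 ∧ climb f a.1 (b.1 - a.1) a.2 ≤ b.2)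

theorem precedes_iff_of_le {f : ℕ → β → β} {a b : ℕ × β} (h : b.1 ≤ a.1) :
    Precedes f a b ↔ a.2 < climb f b.1 (a.1 - b.1) b.2 := by
  simp [Precedes, h, h.not_gt]

theorem not_precedes_iff_of_le {f : ℕ → β → β} {a b : ℕ × β} (h : b.1 ≤ a.1) :
    ¬ Precedes f a b ↔ climb f b.1 (a.1 - b.1) b.2 ≤ a.2 := by
  rw [precedes_iff_of_le h, not_lt]

theorem not_precedes_iff_of_lt {f : ℕ → β → β} {a b : ℕ × β} (h : a.1 < b.1) :
    ¬ Precedes f a b ↔ b.2 < climb f a.1 (b.1 - a.1) a.2 := by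
  simp [Precedes, h, h.not_ge]

theorem precedes_asymm {f : ℕ → β → β} {a b : ℕ × β} (h : Precedes f a b) : ¬ Precedes f b a := by
  rcases lt_trichotomy a.1 b.1 with hab | hab | hab
  · rw [not_precedes_iff_of_le hab.le]
    by_contra hc
    exact (not_precedes_iff_of_lt hab).2 (not_le.1 hc) h
  · rw [not_precedes_iff_of_le hab.le]
    rw [precedes_iff_of_le hab.ge] at h
    simp only [hab, tsub_self, climb] at h ⊢
    exact h.le
  · rw [not_precedes_iff_of_lt hab]
    exact (precedes_iff_of_le hab.le).1 h

/-- Read `¬ Precedes f b a` as "a is at most b". Of the three values, those on lower layers are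
transported upwards until the two given inequalities share a layer; a comparison known only after
transport is pulled back by monotonicity, which reflects strict inequalities. The tie rule makes the
strict and weak inequalities fit in every order of the layers. -/
theorem not_precedes_trans {f : ℕ → β → β} (hf : ∀ m, Monotone (f m)) {a b c : ℕ × β}
    (hab : ¬ Precedes f b a) (hbc : ¬ Precedes f c b) : ¬ Precedes f c a := by
  have hm := fun m k => climb_mono hf m k
  rcases le_or_gt a.1 b.1 with h1 | h1 <;> rcases le_or_gt b.1 c.1 with h2 | h2 <;>
    rcases le_or_gt a.1 c.1 with h3 | h3 <;>
    simp only [not_precedes_iff_of_le, not_precedes_iff_of_lt, h1, h2, h3] at hab hbc ⊢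
  · rw [← climb_climb f h1 h2]
    exact (hm _ _ hab).trans hbc
  · omega
  · rw [← climb_climb f h3 h2.le] at hab
    exact ((hm _ _).reflect_lt (hab.trans_lt hbc)).le
  · rw [← climb_climb f h3.le h1] at hbc
    exact (hm _ _).reflect_lt (hab.trans_lt hbc)
  · rw [← climb_climb f h1.le h3] at hbc
    exact (hm _ _ hab.le).trans hbc
  · rw [← climb_climb f h2 h3.le] at hab
    exact hab.trans_le (hm _ _ hbc)
  · omega
  · rw [← climb_climb f h2.le h1.le]
    exact hab.trans_le (hm _ _ hbc.le)

/-- Finitely many values on layers can be numbered compatibly with `Precedes`. -/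
theorem exists_rank {ι : Type*} [Fintype ι] {f : ℕ → β → β} (hf : ∀ m, Monotone (f m))
    (g : ι → ℕ × β) :
    ∃ r : ι → ℕ, (∀ i, r i ≤ Fintype.card ι) ∧ ∀ i j, r i < r j ↔ Precedes f (g i) (g j) := by
  classical
  -- The rank is the number of predecessors, which represents the order because asymmetry and
  -- negative transitivity make it a strict weak order.
  refine ⟨fun j => (Finset.univ.filter fun i => Precedes f (g i) (g j)).card,
    fun i => Finset.card_le_univ _, fun i j => ⟨fun h => ?_, fun h => ?_⟩⟩
  · by_contra hn
    refine h.not_ge (Finset.card_le_card fun k hk => ?_)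
    simp only [Finset.mem_filter, Finset.mem_univ, true_and] at hk ⊢
    by_contra hk'
    exact not_precedes_trans hf hn hk' hk
  · refine Finset.card_lt_card ⟨fun k hk => ?_, fun hs => ?_⟩
    · simp only [Finset.mem_filter, Finset.mem_univ, true_and] at hk ⊢
      by_contra hk'
      exact not_precedes_trans hf (precedes_asymm h) hk' hk
    · have := hs (Finset.mem_filter.2 ⟨Finset.mem_univ i, h⟩)
      simp only [Finset.mem_filter, Finset.mem_univ, true_and] at this
      exact precedes_asymm this this

end Rank

/-! ### Distances as numbers of alternating threshold steps. -/

/-- The first coordinate of `p` if `m` is odd, the second one if `m` is even. -/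
def coord (m : ℕ) (p : Pt) : ℚ := if m % 2 = 1 then p.1 else p.2

theorem coord_congr {m k : ℕ} (h : m % 2 = k % 2) : coord m = coord k := by
  funext p
  simp [coord, h]

theorem coord_odd {m : ℕ} (h : m % 2 = 1) (p : Pt) : coord m p = p.1 := by simp [coord, h]

theorem coord_mono {p q : Pt} (h : p ≤ q) (m : ℕ) : coord m p ≤ coord m q := by
  unfold coord
  split_ifs
  exacts [h.1, h.2]

/-- The largest coordinate of index `m + 1` of the points of `S` whose coordinate of index `m` is
less than `x`. -/
def reach (S : Finset Pt) (m : ℕ) (x : WithBot ℚ) : WithBot ℚ :=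
  (S.filter fun q => ((coord m q : ℚ) : WithBot ℚ) < x).sup fun q => ((coord (m + 1) q : ℚ) : WithBot ℚ)

theorem lt_reach_iff {S : Finset Pt} {m : ℕ} {x y : WithBot ℚ} :
    y < reach S m x ↔ ∃ q ∈ S, (coord m q : WithBot ℚ) < x ∧ y < (coord (m + 1) q : WithBot ℚ) := by
  simp [reach, Finset.lt_sup_iff, and_assoc]

theorem le_reach {S : Finset Pt} {m : ℕ} {x : WithBot ℚ} {q : Pt} (hq : q ∈ S)
    (h : (coord m q : WithBot ℚ) < x) : (coord (m + 1) q : WithBot ℚ) ≤ reach S m x :=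
  Finset.le_sup (f := fun q => ((coord (m + 1) q : ℚ) : WithBot ℚ)) (Finset.mem_filter.2 ⟨hq, h⟩)

theorem reach_mono (S : Finset Pt) (m : ℕ) : Monotone (reach S m) := fun _ _ h =>
  Finset.sup_mono fun _ hq =>
    Finset.mem_filter.2 ⟨(Finset.mem_filter.1 hq).1, (Finset.mem_filter.1 hq).2.trans_le h⟩

theorem reach_add_two (S : Finset Pt) (m : ℕ) : reach S (m + 2) = reach S m := by
  unfold reach
  rw [coord_congr (show (m + 2) % 2 = m % 2 by omega),
    coord_congr (show (m + 2 + 1) % 2 = (m + 1) % 2 by omega)]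

theorem climb_reach_congr (S : Finset Pt) {m k : ℕ} (h : m % 2 = k % 2) (j : ℕ) :
    climb (reach S) m j = climb (reach S) k j := by
  have key : ∀ a b : ℕ, climb (reach S) (a + 2 * b) j = climb (reach S) a j := by
    intro a b
    induction b with
    | zero => rfl
    | succ b ih => rw [mul_add, mul_one, ← add_assoc, climb_congr (reach_add_two S), ih]
  have h1 := key (m % 2) (m / 2)
  have h2 := key (k % 2) (k / 2)
  rw [Nat.mod_add_div] at h1 h2
  rw [h1, h2, h]

theorem adj_of_coord_lt {S : Finset Pt} {p q : Pt} (hp : p ∈ S) (hq : q ∈ S) (m : ℕ)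
    (h : coord m p < coord m q) (hn : ¬ p ≤ q) : (ptGraph S).Adj p q := by
  refine ⟨hp, hq, ?_⟩
  rw [Prod.le_def, not_and_or, not_le, not_le] at hn
  unfold coord at h
  unfold InTL InBR
  split_ifs at h
  · rcases hn with hn | hn
    · exact absurd h hn.not_gt
    · exact Or.inr ⟨h, hn⟩
  · rcases hn with hn | hn
    · exact Or.inl ⟨hn, h⟩
    · exact absurd h hn.not_gt

/-- The coordinate in which the first of two adjacent points is smaller. -/
theorem exists_coord_lt {S : Finset Pt} {p q : Pt} (h : (ptGraph S).Adj p q) :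
    ∃ m, coord m p < coord m q ∧ coord (m + 1) q < coord (m + 1) p := by
  rcases h.2.2 with h | h
  · exact ⟨0, h.2, h.1⟩
  · exact ⟨1, h.1, h.2⟩

/-- The last threshold is a coordinate of some `q` that was itself reached one step earlier. If `q ≤
u`, then `u` already exceeds `v` in that coordinate and is adjacent to `v`; if `v ≤ q`, then `v` was
reached as early as `q`; otherwise `v` and `q` are adjacent and the walk to `q` is extended. -/
theorem exists_walk_of_lt_climb {S : Finset Pt} {u : Pt} (hu : u ∈ S) (m j : ℕ) :
    ∀ v ∈ S, ¬ v ≤ u →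
      (coord (m + j) v : WithBot ℚ) < climb (reach S) m j (coord m u : WithBot ℚ) →
      ∃ w : (ptGraph S).Walk u v, w.length ≤ j + 1 := by
  induction j with
  | zero =>
    intro v hv hvu h
    exact ⟨(adj_of_coord_lt hv hu m (WithBot.coe_lt_coe.1 h) hvu).symm.toWalk, by simp⟩
  | succ j ih =>
    intro v hv hvu h
    obtain ⟨q, hq, hq1, hq2⟩ := lt_reach_iff.1 h
    have hq2 : coord (m + j + 1) v < coord (m + j + 1) q := WithBot.coe_lt_coe.1 hq2
    by_cases hqu : q ≤ u
    · exact ⟨(adj_of_coord_lt hv hu _ (hq2.trans_le (coord_mono hqu _)) hvu).symm.toWalk, by simp⟩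
    by_cases hvq : v ≤ q
    · obtain ⟨w, hw⟩ := ih v hv hvu
        ((WithBot.coe_le_coe.2 (coord_mono hvq (m + j))).trans_lt hq1)
      exact ⟨w, by omega⟩
    · obtain ⟨w, hw⟩ := ih q hq hqu hq1
      exact ⟨w.concat (adj_of_coord_lt hv hq _ hq2 hvq).symm, by simpa using hw⟩

/-- An edge decreases one coordinate and increases the other when it is followed to the new point.
The decreasing coordinate inherits the old bound; the increasing one is captured by `reach`, at the
cost of one step, since the decreasing one is strictly below its threshold. -/
theorem coord_le_climb_of_walk {S : Finset Pt} {p u : Pt} (w : (ptGraph S).Walk p u) (a : ℕ) :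
    ∃ j ≤ w.length, ∃ m, (m + j) % 2 = a % 2 ∧
      (coord a p : WithBot ℚ) ≤ climb (reach S) m j (coord m u : WithBot ℚ) := by
  induction w generalizing a with
  | nil => exact ⟨0, le_rfl, a, rfl, le_rfl⟩
  | @cons p p' u h w ih =>
    obtain ⟨b, hb1, hb2⟩ := exists_coord_lt h
    by_cases hab : a % 2 = b % 2
    · obtain ⟨j, hj, m, hm, hle⟩ := ih a
      refine ⟨j, hj.trans (by simp), m, hm, le_trans ?_ hle⟩
      rw [coord_congr hab]
      exact WithBot.coe_le_coe.2 hb1.le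
    · obtain ⟨j, hj, m, hm, hle⟩ := ih b
      refine ⟨j + 1, by simpa using hj, m, by omega, ?_⟩
      have := le_reach (S := S) (m := m + j) h.1 (x := climb (reach S) m j (coord m u : WithBot ℚ)) ?_
      · rwa [coord_congr (show (m + j + 1) % 2 = a % 2 by omega)] at this
      · rw [coord_congr hm]
        exact (WithBot.coe_lt_coe.2 hb1).trans_le hle

theorem lt_climb_of_walk {S : Finset Pt} {v u : Pt} (hvu : ¬ v ≤ u) (w : (ptGraph S).Walk v u) :
    ∃ j < w.length, ∃ m,
      (coord (m + j) v : WithBot ℚ) < climb (reach S) m j (coord m u : WithBot ℚ) := by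
  cases w with
  | nil => exact absurd le_rfl hvu
  | cons h w =>
    obtain ⟨b, hb, -⟩ := exists_coord_lt h
    obtain ⟨j, hj, m, hm, hle⟩ := coord_le_climb_of_walk w b
    refine ⟨j, by simpa using Nat.lt_succ_of_le hj, m, ?_⟩
    rw [coord_congr hm]
    exact (WithBot.coe_lt_coe.2 hb).trans_le hle

/-- The distance of two points is determined by the values reached from the coordinates of the
first one. -/
theorem dist_eq {S : Finset Pt} {u v : Pt} (hu : u ∈ S) (hv : v ∈ S) (hvu : ¬ v ≤ u)
    (hr : (ptGraph S).Reachable u v) :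
    (ptGraph S).dist u v = 1 + sInf {k | ∃ m,
      (coord (m + k) v : WithBot ℚ) < climb (reach S) m k (coord m u : WithBot ℚ)} := by
  obtain ⟨w, hw⟩ := hr.symm.exists_walk_length_eq_dist
  obtain ⟨j, hj, hmem⟩ := lt_climb_of_walk hvu w
  rw [hw, SimpleGraph.dist_comm] at hj
  refine le_antisymm ?_ ?_
  · obtain ⟨m, hm⟩ := Nat.sInf_mem (s := {k | ∃ m,
      (coord (m + k) v : WithBot ℚ) < climb (reach S) m k (coord m u : WithBot ℚ)}) ⟨j, hmem⟩
    obtain ⟨w, hw⟩ := exists_walk_of_lt_climb hu m _ v hv hvu hm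
    exact (SimpleGraph.dist_le w).trans (by omega)
  · have := Nat.sInf_le (s := {k | ∃ m,
      (coord (m + k) v : WithBot ℚ) < climb (reach S) m k (coord m u : WithBot ℚ)}) hmem
    omega

/-! ### Layers of coordinates, and how they control the climbs. -/

section Layers

/-- The `k`-th value reached from the second coordinate of `s`. -/
def front (S : Finset Pt) (s : Pt) (k : ℕ) : WithBot ℚ :=
  climb (reach S) 0 k (coord 0 s : WithBot ℚ)

/-- `s` is a leftmost point of `S` with a neighbour, and the points of `S` have distinct first
coordinates. -/
structure IsLeftEnd (S : Finset Pt) (s : Pt) : Prop where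
  mem : s ∈ S
  fst_le : ∀ q ∈ S, s.1 ≤ q.1
  injOn : ∀ p ∈ S, ∀ q ∈ S, p.1 = q.1 → p = q
  exists_inBR : ∃ q ∈ S, InBR s q

variable {S : Finset Pt} {s : Pt}

theorem front_succ (k : ℕ) : front S s (k + 1) = reach S k (front S s k) := by
  simp [front, climb]

theorem climb_front {m a : ℕ} (h : m % 2 = a % 2) (k : ℕ) :
    climb (reach S) m k (front S s a) = front S s (a + k) := by
  rw [front, front, climb_add, zero_add, climb_reach_congr S h]

/-- The first front already exceeds the first coordinate of `s`, so `s` itself counts in the next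
step and the second front is at least the starting value. Monotone climbing carries this to all `k`.
-/
theorem IsLeftEnd.front_le_add_two (hs : IsLeftEnd S s) (k : ℕ) :
    front S s k ≤ front S s (k + 2) := by
  obtain ⟨q, hq, hsq⟩ := hs.exists_inBR
  have h1 : ((coord 1 s : ℚ) : WithBot ℚ) < reach S 0 (coord 0 s : WithBot ℚ) :=
    lt_reach_iff.2 ⟨q, hq, WithBot.coe_lt_coe.2 hsq.2, WithBot.coe_lt_coe.2 hsq.1⟩
  have h2 : front S s 0 ≤ front S s 2 := le_reach hs.mem h1
  have h3 := climb_mono (reach_mono S) 0 k h2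
  rwa [climb_front (m := 0) (a := 0) rfl, climb_front (m := 0) (a := 2) rfl, zero_add, add_comm] at h3

theorem IsLeftEnd.front_mono (hs : IsLeftEnd S s) {i j : ℕ} (hij : i ≤ j) (h : i % 2 = j % 2) :
    front S s i ≤ front S s j := by
  obtain ⟨k, rfl⟩ : ∃ k, j = i + 2 * k := ⟨(j - i) / 2, by omega⟩
  clear hij h
  induction k with
  | zero => exact le_rfl
  | succ k ih => exact ih.trans (hs.front_le_add_two _)

/-- Nothing lies to the left of `s`, so a climb from its first coordinate finds no point at all.
This is why `front` only starts from the second coordinate. -/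
theorem IsLeftEnd.not_lt_climb (hs : IsLeftEnd S s) {m : ℕ} (hm : m % 2 = 1) (k : ℕ) :
    ∀ v ∈ S, ¬ (coord (m + k) v : WithBot ℚ) < climb (reach S) m k (coord m s : WithBot ℚ) := by
  induction k with
  | zero =>
    intro v hv h
    have := WithBot.coe_lt_coe.1 h
    rw [add_zero, coord_odd hm, coord_odd hm] at this
    exact this.not_ge (hs.fst_le v hv)
  | succ k ih =>
    intro v _ h
    obtain ⟨q, hq, hlt, -⟩ := lt_reach_iff.1 h
    exact ih q hq hlt

theorem IsLeftEnd.lt_front (hs : IsLeftEnd S s) {v : Pt} (hv : v ∈ S) {m k : ℕ}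
    (h : (coord (m + k) v : WithBot ℚ) < climb (reach S) m k (coord m s : WithBot ℚ)) :
    (coord k v : WithBot ℚ) < front S s k := by
  have hm : m % 2 = 0 := by
    by_contra hm
    exact hs.not_lt_climb (by omega) k v hv h
  rwa [climb_reach_congr S (show m % 2 = 0 % 2 from hm), coord_congr (show (m + k) % 2 = k % 2 by omega),
    coord_congr (show m % 2 = 0 % 2 from hm)] at h

/-- `m` is the layer of the coordinate of index `m` of `v`. -/
def IsLayer (S : Finset Pt) (s v : Pt) (m : ℕ) : Prop :=
  (coord m v : WithBot ℚ) < front S s m ∧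
    ∀ i, i % 2 = m % 2 → (coord i v : WithBot ℚ) < front S s i → m ≤ i

/-- Among the points exceeding `v` in coordinate `a`, `p` is the easiest to capture, having the
least other coordinate. So the front passes coordinate `a` of `v` exactly one step after it first
captures `p`, and by `dist_eq` that step has number `dist s p`. The last hypothesis excludes layer
0, which precedes any capture. -/
theorem IsLeftEnd.isLayer_dist (hs : IsLeftEnd S s) {p v : Pt} (hp : p ∈ S) (hps : ¬ p ≤ s)
    (hr : (ptGraph S).Reachable s p) {a : ℕ} (hlt : coord a v < coord a p)
    (hmin : ∀ q ∈ S, coord a v < coord a q → coord (a + 1) p ≤ coord (a + 1) q)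
    (hzero : a % 2 = 0 → ¬ coord 0 v < coord 0 s) :
    (ptGraph S).dist s p % 2 = a % 2 ∧ IsLayer S s v ((ptGraph S).dist s p) := by
  set A := {k | ∃ m, (coord (m + k) p : WithBot ℚ) < climb (reach S) m k (coord m s : WithBot ℚ)}
    with hA
  have hd : (ptGraph S).dist s p = 1 + sInf A := dist_eq hs.mem hp hps hr
  obtain ⟨w, -⟩ := hr.symm.exists_walk_length_eq_dist
  obtain ⟨j, -, hj⟩ := lt_climb_of_walk hps w
  obtain ⟨m, hm⟩ := Nat.sInf_mem (s := A) ⟨j, hj⟩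
  have hK := hs.lt_front hp hm
  have hmin' : ∀ i, i % 2 = a % 2 → (coord i v : WithBot ℚ) < front S s i → 1 + sInf A ≤ i := by
    intro i hi hlti
    obtain _ | i := i
    · exact absurd (WithBot.coe_lt_coe.1 hlti) (hzero hi.symm)
    · rw [front_succ] at hlti
      obtain ⟨q, hq, hq1, hq2⟩ := lt_reach_iff.1 hlti
      have hq2 := WithBot.coe_lt_coe.1 hq2
      rw [coord_congr hi] at hq2
      have hq3 := hmin q hq hq2
      rw [coord_congr (show (a + 1) % 2 = i % 2 by omega)] at hq3
      have : sInf A ≤ i := by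
        refine Nat.sInf_le ⟨0, ?_⟩
        rw [zero_add]
        exact (WithBot.coe_le_coe.2 hq3).trans_lt hq1
      omega
  -- With the wrong parity, the front capturing `p` would already exceed coordinate `a` of `v`, one
  -- step earlier than `hmin'` permits.
  have hpar : (1 + sInf A) % 2 = a % 2 := by
    by_contra hne
    have := hmin' (sInf A) (by omega) ?_
    · omega
    · refine lt_trans (WithBot.coe_lt_coe.2 ?_) hK
      rwa [coord_congr (show sInf A % 2 = a % 2 by omega)]
  rw [hd]
  refine ⟨hpar, ?_, fun i hi => hmin' i (hi.trans hpar)⟩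
  rw [add_comm, front_succ]
  refine lt_of_lt_of_le (WithBot.coe_lt_coe.2 ?_) (le_reach hp hK)
  rwa [coord_congr (show (sInf A + 1) % 2 = a % 2 by omega)]

theorem exists_bottomBoundary_of_mem {q : Pt} (hq : q ∈ S) :
    ∃ r ∈ bottomBoundary S, q.1 ≤ r.1 ∧ r.2 ≤ q.2 := by
  by_cases hb : q ∈ bottomBoundary S
  · exact ⟨q, hb, le_rfl, le_rfl⟩
  · simp only [bottomBoundary, Finset.mem_filter, not_and, not_forall, not_not] at hb
    obtain ⟨p, hp, h⟩ := hb hq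
    obtain ⟨r, hr⟩ := bottomNbrs_nonempty hp h
    obtain ⟨hr1, hr2⟩ := Finset.mem_filter.1 hr
    refine ⟨r, hr1, ?_⟩
    rcases hr2 with hr2 | hr2
    · exact absurd ⟨hr2.1, hr2.2⟩ ((Finset.mem_filter.1 hr1).2 q hq)
    · exact ⟨hr2.1.le, hr2.2.le⟩

theorem exists_topBoundary_of_mem {q : Pt} (hq : q ∈ S) :
    ∃ r ∈ topBoundary S, r.1 ≤ q.1 ∧ q.2 ≤ r.2 := by
  by_cases hb : q ∈ topBoundary S
  · exact ⟨q, hb, le_rfl, le_rfl⟩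
  · simp only [topBoundary, Finset.mem_filter, not_and, not_forall, not_not] at hb
    obtain ⟨p, hp, h⟩ := hb hq
    obtain ⟨r, hr⟩ := topNbrs_nonempty hp h
    obtain ⟨hr1, hr2⟩ := Finset.mem_filter.1 hr
    refine ⟨r, hr1, ?_⟩
    rcases hr2 with hr2 | hr2
    · exact ⟨hr2.1.le, hr2.2.le⟩
    · exact absurd ⟨hr2.1, hr2.2⟩ ((Finset.mem_filter.1 hr1).2 q hq)

theorem mem_bottomNbrs_iff {v p : Pt} (hv : v ∈ S) :
    p ∈ bottomNbrs S v ↔ p ∈ bottomBoundary S ∧ InBR v p := by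
  refine ⟨fun h => ?_, fun h => Finset.mem_filter.2 ⟨h.1, Or.inr h.2⟩⟩
  obtain ⟨h1, h2⟩ := Finset.mem_filter.1 h
  exact ⟨h1, h2.resolve_left fun h3 => (Finset.mem_filter.1 h1).2 v hv ⟨h3.1, h3.2⟩⟩

theorem mem_topNbrs_iff {v p : Pt} (hv : v ∈ S) :
    p ∈ topNbrs S v ↔ p ∈ topBoundary S ∧ InTL v p := by
  refine ⟨fun h => ?_, fun h => Finset.mem_filter.2 ⟨h.1, Or.inl h.2⟩⟩
  obtain ⟨h1, h2⟩ := Finset.mem_filter.1 h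
  exact ⟨h1, h2.resolve_right fun h3 => (Finset.mem_filter.1 h1).2 v hv ⟨h3.1, h3.2⟩⟩

/-- The first bottom neighbour is the lowest point to the right of `v`: below any lower one there
would be a boundary neighbour of `v` in the bottom-right quadrant of `Bfirst`. -/
theorem IsLeftEnd.isLayer_Bfirst (hs : IsLeftEnd S s) {v : Pt} (hv : v ∈ S)
    (hn : (bottomNbrs S v).Nonempty) (hr : (ptGraph S).Reachable s v) :
    (ptGraph S).dist s (Bfirst S v) % 2 = 1 ∧
      IsLayer S s v ((ptGraph S).dist s (Bfirst S v)) := by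
  obtain ⟨hb, hmin⟩ := first_spec hn
  change Bfirst S v ∈ _ at hb
  change ∀ q ∈ bottomNbrs S v, (Bfirst S v).1 ≤ q.1 at hmin
  set b := Bfirst S v
  obtain ⟨hbb, hvb⟩ := (mem_bottomNbrs_iff hv).1 hb
  obtain ⟨hbS, hbe⟩ := Finset.mem_filter.1 hbb
  refine hs.isLayer_dist (a := 1) hbS (fun h => ?_) ?_ hvb.1 ?_ (by norm_num)
  · exact (hvb.1.trans_le (h.1.trans (hs.fst_le v hv))).false
  · exact hr.trans (SimpleGraph.Adj.reachable ⟨hv, hbS, Or.inr hvb⟩)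
  · intro q hq hvq
    by_contra! hlt
    replace hvq : v.1 < q.1 := hvq
    replace hlt : q.2 < b.2 := hlt
    obtain ⟨r, hr, hr1, hr2⟩ := exists_bottomBoundary_of_mem hq
    have hbr := hmin r ((mem_bottomNbrs_iff hv).2
      ⟨hr, hvq.trans_le hr1, hr2.trans_lt (hlt.trans hvb.2)⟩)
    have hrS := (Finset.mem_filter.1 hr).1
    rcases hbr.lt_or_eq with h | h
    · exact hbe r hrS ⟨h, hr2.trans_lt hlt⟩
    · rw [← hs.injOn b hbS r hrS h] at hr2
      exact hr2.not_gt hlt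

theorem IsLeftEnd.isLayer_Tfirst (hs : IsLeftEnd S s) {v : Pt} (hv : v ∈ S)
    (hn : (topNbrs S v).Nonempty) (hr : (ptGraph S).Reachable s v) :
    (ptGraph S).dist s (Tfirst S v) % 2 = 0 ∧
      IsLayer S s v ((ptGraph S).dist s (Tfirst S v)) := by
  obtain ⟨ht, hmin⟩ := first_spec hn
  change Tfirst S v ∈ _ at ht
  change ∀ q ∈ topNbrs S v, (Tfirst S v).1 ≤ q.1 at hmin
  set t := Tfirst S v
  obtain ⟨htb, hvt⟩ := (mem_topNbrs_iff hv).1 ht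
  obtain ⟨htS, hte⟩ := Finset.mem_filter.1 htb
  -- Here the layer is 0, a case outside `isLayer_dist`. Otherwise `s`, which is on the top
  -- boundary, is no neighbour of `v`, and this gives the condition on layer 0.
  by_cases hts : t = s
  · rw [hts, SimpleGraph.dist_self]
    refine ⟨rfl, WithBot.coe_lt_coe.2 ?_, fun i _ _ => Nat.zero_le i⟩
    rw [hts] at hvt
    exact hvt.2
  have hlt : s.1 < t.1 :=
    (hs.fst_le t htS).lt_of_ne fun h => hts (hs.injOn s hs.mem t htS h).symm
  refine hs.isLayer_dist (a := 0) htS (fun h => hlt.not_ge h.1) ?_ hvt.2 ?_ fun _ h => ?_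
  · exact hr.trans (SimpleGraph.Adj.reachable ⟨hv, htS, Or.inl hvt⟩)
  · intro q hq hvq
    by_contra! hqt
    replace hvq : v.2 < q.2 := hvq
    replace hqt : q.1 < t.1 := hqt
    obtain ⟨r, hr, hr1, hr2⟩ := exists_topBoundary_of_mem hq
    have := hmin r ((mem_topNbrs_iff hv).2
      ⟨hr, hr1.trans_lt (hqt.trans hvt.1), hvq.trans_le hr2⟩)
    exact (this.trans hr1).not_gt hqt
  · refine hlt.not_ge (hmin s ((mem_topNbrs_iff hv).2 ⟨Finset.mem_filter.2 ⟨hs.mem, ?_⟩,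
      hlt.trans hvt.1, h⟩))
    exact fun q hq hsq => hsq.1.not_ge (hs.fst_le q hq)

/-- Values reached from a coordinate of `u` are compared with a coordinate of `v` by the layers of
these coordinates, and by `Precedes` if the layers do not decide. -/
theorem IsLeftEnd.lt_climb_iff (hs : IsLeftEnd S s) {u v : Pt} (hTL : ∃ q ∈ S, InTL u q)
    (hBR : ∃ q ∈ S, InBR u q) {m n k : ℕ} (hu : IsLayer S s u m) (hv : IsLayer S s v n)
    (hpar : (m + k) % 2 = n % 2) :
    (coord n v : WithBot ℚ) < climb (reach S) m k (coord m u : WithBot ℚ) ↔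
      n < m + k ∨ (m + k = n ∧
        Precedes (reach S) (n, (coord n v : WithBot ℚ)) (m, (coord m u : WithBot ℚ))) := by
  have hmono := fun a b => climb_mono (reach_mono S) a b
  rcases lt_trichotomy n (m + k) with h | h | h
  · simp only [h, true_or, iff_true]
    have hsu : s.1 < u.1 := by
      obtain ⟨q, hq, h⟩ := hTL
      exact (hs.fst_le q hq).trans_lt h.1
    suffices ∃ a, (a + 2 = m + k) ∧ front S s a ≤ climb (reach S) m k (coord m u : WithBot ℚ) by
      obtain ⟨a, ha, hle⟩ := this
      exact hv.1.trans_le ((hs.front_mono (by omega) (by omega)).trans hle)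
    -- For layers at least 2, minimality puts the coordinate of `u` at or above the front two
    -- indices earlier. On layers 0 and 1 there is no such front; instead two steps, respectively
    -- one step, from `u` capture `s` and so attain the starting front. The parity condition ensures
    -- that `k` is large enough.
    obtain _ | _ | m := m
    · obtain ⟨k, rfl⟩ : ∃ l, k = 2 + l := ⟨k - 2, by omega⟩
      refine ⟨k, by omega, ?_⟩
      rw [climb_add, ← zero_add k, ← climb_front (m := 0 + 2) (a := 0) rfl, zero_add k]
      refine hmono _ _ (le_reach (m := 1) hs.mem (lt_reach_iff.2 ?_))
      obtain ⟨q, hq, h⟩ := hBR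
      exact ⟨q, hq, WithBot.coe_lt_coe.2 h.2, WithBot.coe_lt_coe.2 (hsu.trans h.1)⟩
    · obtain ⟨k, rfl⟩ : ∃ l, k = 1 + l := ⟨k - 1, by omega⟩
      refine ⟨k, by omega, ?_⟩
      rw [climb_add, ← zero_add k, ← climb_front (m := 0 + 1 + 1) (a := 0) rfl, zero_add k]
      exact hmono _ _ (le_reach (m := 1) hs.mem (WithBot.coe_lt_coe.2 hsu))
    · refine ⟨m + k, by omega, ?_⟩
      rw [← climb_front (m := m + 1 + 1) (by omega)]
      refine hmono _ _ (not_lt.1 fun hlt => ?_)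
      have := hu.2 m (by omega) (by rwa [coord_congr (show m % 2 = (m + 1 + 1) % 2 by omega)])
      omega
  · subst h
    rw [precedes_iff_of_le (Nat.le_add_right m k)]
    simp
  · simp only [h.not_gt, h.ne, false_and, or_self, iff_false, not_lt]
    refine (hmono m k hu.1.le).trans ?_
    rw [climb_front rfl]
    refine not_lt.1 fun hlt => ?_
    have := hv.2 (m + k) hpar (by rwa [coord_congr hpar])
    omega

end Layers

/-! ### Explicit coordinates of the augmented set. -/

section Placement

variable {n : ℕ} {π : Equiv.Perm (Fin n)}

theorem gridPoint_mem (i : Fin n) : gridPoint π i ∈ inputPoints π :=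
  Finset.mem_image_of_mem _ (Finset.mem_univ i)

theorem exists_gridPoint {v : Pt} (hv : v ∈ inputPoints π) : ∃ i, gridPoint π i = v := by
  simpa [inputPoints] using hv

theorem gridPoint_fst_le_iff {i j : Fin n} : (gridPoint π i).1 ≤ (gridPoint π j).1 ↔ i ≤ j := by
  simp [gridPoint]

theorem gridPoint_snd_le_iff {i j : Fin n} :
    (gridPoint π i).2 ≤ (gridPoint π j).2 ↔ π.symm i ≤ π.symm j := by
  simp [gridPoint]

theorem gridPoint_fst_lt_iff {i j : Fin n} : (gridPoint π i).1 < (gridPoint π j).1 ↔ i < j := by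
  simp [gridPoint]

theorem gridPoint_snd_lt_iff {i j : Fin n} :
    (gridPoint π i).2 < (gridPoint π j).2 ↔ π.symm i < π.symm j := by
  simp [gridPoint]

theorem gridPoint_injective : Function.Injective (gridPoint π) := fun _ _ h =>
  le_antisymm (gridPoint_fst_le_iff.1 (congrArg Prod.fst h).le)
    (gridPoint_fst_le_iff.1 (congrArg Prod.fst h).ge)

theorem permGraph_adj_iff {i j : Fin n} : (permGraph π).Adj i j ↔
    InTL (gridPoint π i) (gridPoint π j) ∨ InBR (gridPoint π i) (gridPoint π j) := by
  simp only [InTL, InBR, gridPoint_fst_lt_iff, gridPoint_snd_lt_iff]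
  exact or_comm

theorem permGraph_adj_of_lt_snd {i j : Fin n} (h1 : (gridPoint π i).1 ≤ (gridPoint π j).1)
    (h2 : (gridPoint π j).2 < (gridPoint π i).2) : (permGraph π).Adj i j := by
  refine permGraph_adj_iff.2 (Or.inr ⟨h1.lt_of_ne fun h => ?_, h2⟩)
  rw [le_antisymm (gridPoint_fst_le_iff.1 h.le) (gridPoint_fst_le_iff.1 h.ge)] at h2
  exact h2.false

theorem permGraph_adj_of_lt_fst {i j : Fin n} (h1 : (gridPoint π i).1 < (gridPoint π j).1)
    (h2 : (gridPoint π j).2 ≤ (gridPoint π i).2) : (permGraph π).Adj i j := by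
  refine permGraph_adj_iff.2 (Or.inr ⟨h1, h2.lt_of_ne fun h => ?_⟩)
  have := π.symm.injective
    (le_antisymm (gridPoint_snd_le_iff.1 h.le) (gridPoint_snd_le_iff.1 h.ge))
  rw [this] at h1
  exact h1.false

/-- Coordinates of input points are integers between `1` and `n`. -/
theorem exists_nat_coords {v : Pt} (hv : v ∈ inputPoints π) :
    ∃ a b : ℕ, v = ((a : ℚ), (b : ℚ)) ∧ 1 ≤ a ∧ a ≤ n ∧ 1 ≤ b ∧ b ≤ n := by
  obtain ⟨i, rfl⟩ := exists_gridPoint hv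
  exact ⟨i + 1, π.symm i + 1, by simp [gridPoint], by omega, by omega, by omega, by omega⟩

theorem input_bounds {v : Pt} (hv : v ∈ inputPoints π) :
    1 ≤ v.1 ∧ v.1 ≤ n ∧ 1 ≤ v.2 ∧ v.2 ≤ n := by
  obtain ⟨a, b, rfl, h1, h2, h3, h4⟩ := exists_nat_coords hv
  exact ⟨Nat.one_le_cast.2 h1, Nat.cast_le.2 h2, Nat.one_le_cast.2 h3, Nat.cast_le.2 h4⟩

theorem input_eq_of_fst {u v : Pt} (hu : u ∈ inputPoints π) (hv : v ∈ inputPoints π)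
    (h : u.1 = v.1) : u = v := by
  obtain ⟨i, rfl⟩ := exists_gridPoint hu
  obtain ⟨j, rfl⟩ := exists_gridPoint hv
  rw [le_antisymm (gridPoint_fst_le_iff.1 h.le) (gridPoint_fst_le_iff.1 h.ge)]

theorem input_eq_of_snd {u v : Pt} (hu : u ∈ inputPoints π) (hv : v ∈ inputPoints π)
    (h : u.2 = v.2) : u = v := by
  obtain ⟨i, rfl⟩ := exists_gridPoint hu
  obtain ⟨j, rfl⟩ := exists_gridPoint hv
  rw [π.symm.injective (le_antisymm (gridPoint_snd_le_iff.1 h.le) (gridPoint_snd_le_iff.1 h.ge))]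

theorem eps_le (hn : 1 ≤ n) : eps n ≤ 1 / 16 := by
  have : (1 : ℚ) ≤ n := by exact_mod_cast hn
  unfold eps
  rw [div_le_div_iff₀ (by positivity) (by norm_num)]
  linarith

theorem mul_eps_sq_le {x : ℚ} (hx : x ≤ n) : x * eps n ^ 2 ≤ eps n / 8 := by
  have h1 : x * eps n ≤ 1 / 8 := by
    unfold eps
    rw [mul_one_div, div_le_div_iff₀ (by positivity) (by norm_num)]
    linarith
  have h2 := mul_le_mul_of_nonneg_right h1 (eps_pos n).le
  linarith

theorem one_le_of_mem {v : Pt} (hv : v ∈ inputPoints π) : 1 ≤ n := by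
  obtain ⟨a, b, -, h1, h2, -, -⟩ := exists_nat_coords hv
  omega

theorem input_fst_le_of_lt {u v : Pt} (hu : u ∈ inputPoints π) (hv : v ∈ inputPoints π)
    (h : u.1 < v.1 + 2 * eps n) : u.1 ≤ v.1 := by
  have he := eps_le (one_le_of_mem hu)
  obtain ⟨a, b, rfl, -⟩ := exists_nat_coords hu
  obtain ⟨c, d, rfl, -⟩ := exists_nat_coords hv
  have h' : (a : ℚ) < ((c + 1 : ℕ) : ℚ) := by
    push_cast
    dsimp only at h
    linarith
  have h' := Nat.cast_lt.1 h'
  exact Nat.cast_le.2 (by omega)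

theorem input_snd_le_of_lt {u v : Pt} (hu : u ∈ inputPoints π) (hv : v ∈ inputPoints π)
    (h : u.2 < v.2 + 2 * eps n) : u.2 ≤ v.2 := by
  have he := eps_le (one_le_of_mem hu)
  obtain ⟨a, b, rfl, -⟩ := exists_nat_coords hu
  obtain ⟨c, d, rfl, -⟩ := exists_nat_coords hv
  have h' : (b : ℚ) < ((d + 1 : ℕ) : ℚ) := by
    push_cast
    dsimp only at h
    linarith
  have h' := Nat.cast_lt.1 h'
  exact Nat.cast_le.2 (by omega)

theorem mem_stageOne {p : Pt} (hp : p ∈ stageOne π) :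
    ∃ v ∈ inputPoints π, p = v ∨ p = (v.1 + 2 * eps n, v.2 - 2 * eps n) ∨
      p = (v.1 - 2 * eps n, v.2 + 2 * eps n) := by
  simp only [stageOne, Finset.mem_union, Finset.mem_image] at hp
  rcases hp with (hp | ⟨v, hv, rfl⟩) | ⟨v, hv, rfl⟩
  · exact ⟨p, hp, Or.inl rfl⟩
  · exact ⟨v, (Finset.mem_filter.1 hv).1, Or.inr (Or.inl rfl)⟩
  · exact ⟨v, (Finset.mem_filter.1 hv).1, Or.inr (Or.inr rfl)⟩

theorem input_mem_stageOne {v : Pt} (hv : v ∈ inputPoints π) : v ∈ stageOne π :=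
  Finset.mem_union_left _ (Finset.mem_union_left _ hv)

/-- Input points are off the boundary of the first stage, and an upper-left copy has its original in
its bottom-right quadrant. Only lower-right copies remain, and integrality removes the shift from
the inequalities. -/
theorem bottomNbrs_stageOne {v b : Pt} (hv : v ∈ inputPoints π)
    (hb : b ∈ bottomNbrs (stageOne π) v) :
    ∃ c ∈ inputPoints π, b = (c.1 + 2 * eps n, c.2 - 2 * eps n) ∧ v.1 ≤ c.1 ∧ c.2 ≤ v.2 := by
  have he := eps_pos n
  obtain ⟨hb1, hvb⟩ := (mem_bottomNbrs_iff (input_mem_stageOne hv)).1 hb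
  obtain ⟨hbS, hbe⟩ := Finset.mem_filter.1 hb1
  obtain ⟨c, hc, rfl | rfl | rfl⟩ := mem_stageOne hbS
  · obtain ⟨⟨q, hq, h⟩, -⟩ := exists_quadrants π hc
    exact absurd h (hbe q hq)
  · obtain ⟨h1, h2⟩ := hvb
    exact ⟨c, hc, rfl, input_fst_le_of_lt hv hc h1,
      input_snd_le_of_lt hc hv (by dsimp only at h2; linarith)⟩
  · refine absurd ⟨?_, ?_⟩ (hbe c (input_mem_stageOne hc)) <;> dsimp only <;> linarith

theorem topNbrs_stageOne {v t : Pt} (hv : v ∈ inputPoints π)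
    (ht : t ∈ topNbrs (stageOne π) v) :
    ∃ c ∈ inputPoints π, t = (c.1 - 2 * eps n, c.2 + 2 * eps n) ∧ c.1 ≤ v.1 ∧ v.2 ≤ c.2 := by
  have he := eps_pos n
  obtain ⟨ht1, hvt⟩ := (mem_topNbrs_iff (input_mem_stageOne hv)).1 ht
  obtain ⟨htS, hte⟩ := Finset.mem_filter.1 ht1
  obtain ⟨c, hc, rfl | rfl | rfl⟩ := mem_stageOne htS
  · obtain ⟨-, q, hq, h⟩ := exists_quadrants π hc
    exact absurd h (hte q hq)
  · refine absurd ⟨?_, ?_⟩ (hte c (input_mem_stageOne hc)) <;> dsimp only <;> linarith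
  · obtain ⟨h1, h2⟩ := hvt
    exact ⟨c, hc, rfl, input_fst_le_of_lt hc hv (by dsimp only at h1; linarith),
      input_snd_le_of_lt hv hc h2⟩

/-- The points placed next to the input point `v`, with explicit coordinates; `a` is the coefficient
of `eps n` in the first coordinate. -/
inductive Placed (π : Equiv.Perm (Fin n)) (v : Pt) : ℤ → Pt → Prop
  | self : Placed π v 0 v
  | right : Placed π v 2 (v.1 + 2 * eps n, v.2 - 2 * eps n)
  | left : Placed π v (-2) (v.1 - 2 * eps n, v.2 + 2 * eps n)
  | bfirst (c : Pt) (hc : c ∈ inputPoints π) (h1 : v.1 ≤ c.1) (h2 : c.2 ≤ v.2)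
      (h : Bfirst (stageOne π) v = (c.1 + 2 * eps n, c.2 - 2 * eps n)) :
      Placed π v (-1) (v.1 - eps n, c.2 - 3 * eps n + v.1 * eps n ^ 2)
  | blast (c : Pt) (hc : c ∈ inputPoints π) (h1 : v.1 ≤ c.1) (h2 : c.2 ≤ v.2)
      (h : Blast (stageOne π) v = (c.1 + 2 * eps n, c.2 - 2 * eps n)) :
      Placed π v 3 (c.1 + 3 * eps n + v.2 * eps n ^ 2, v.2 + eps n)
  | tfirst (c : Pt) (hc : c ∈ inputPoints π) (h1 : c.1 ≤ v.1) (h2 : v.2 ≤ c.2)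
      (h : Tfirst (stageOne π) v = (c.1 - 2 * eps n, c.2 + 2 * eps n)) :
      Placed π v (-3) (c.1 - 3 * eps n + v.2 * eps n ^ 2, v.2 - eps n)
  | tlast (c : Pt) (hc : c ∈ inputPoints π) (h1 : c.1 ≤ v.1) (h2 : v.2 ≤ c.2)
      (h : Tlast (stageOne π) v = (c.1 - 2 * eps n, c.2 + 2 * eps n)) :
      Placed π v 1 (v.1 + eps n, c.2 + 3 * eps n + v.1 * eps n ^ 2)

theorem exists_placed {p : Pt} (hp : p ∈ augmented π) :
    ∃ v ∈ inputPoints π, ∃ a, Placed π v a p := by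
  rcases Finset.mem_union.1 hp with hp | hp
  · obtain ⟨v, hv, rfl | rfl | rfl⟩ := mem_stageOne hp
    exacts [⟨_, hv, _, .self⟩, ⟨v, hv, _, .right⟩, ⟨v, hv, _, .left⟩]
  · obtain ⟨v, hv, hp⟩ := Finset.mem_biUnion.1 hp
    refine ⟨v, hv, ?_⟩
    obtain ⟨⟨hB, hT⟩, -⟩ := nbrs_nonempty π hv
    simp only [auxPoints, Finset.mem_insert, Finset.mem_singleton] at hp
    rcases hp with rfl | rfl | rfl | rfl
    · obtain ⟨c, hc, h, h1, h2⟩ := bottomNbrs_stageOne hv (first_spec hB).1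
      refine ⟨-1, ?_⟩
      convert Placed.bfirst c hc h1 h2 h using 2
      rw [show Bfirst (stageOne π) v = _ from h]
      ring
    · obtain ⟨c, hc, h, h1, h2⟩ := bottomNbrs_stageOne hv (last_spec hB).1
      refine ⟨3, ?_⟩
      convert Placed.blast c hc h1 h2 h using 2
      rw [show Blast (stageOne π) v = _ from h]
      ring
    · obtain ⟨c, hc, h, h1, h2⟩ := topNbrs_stageOne hv (first_spec hT).1
      refine ⟨-3, ?_⟩
      convert Placed.tfirst c hc h1 h2 h using 2
      rw [show Tfirst (stageOne π) v = _ from h]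
      ring
    · obtain ⟨c, hc, h, h1, h2⟩ := topNbrs_stageOne hv (last_spec hT).1
      refine ⟨1, ?_⟩
      convert Placed.tlast c hc h1 h2 h using 2
      rw [show Tlast (stageOne π) v = _ from h]
      ring

/-- With the integer `M = 8 * (n + 1) = 1 / eps n`, these are digit expansions in base `M`: the
coefficients `b` differ by at most `n` and the coefficients `a` by at most 6, both less than `M`, so
the digits can be read off by divisibility. -/
theorem eps_expansion_unique {k a b k' a' b' : ℤ} (ha : |a| ≤ 3) (ha' : |a'| ≤ 3) (hb : 0 ≤ b)
    (hbn : b ≤ n) (hb' : 0 ≤ b') (hbn' : b' ≤ n)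
    (h : (k : ℚ) + a * eps n + b * eps n ^ 2 = k' + a' * eps n + b' * eps n ^ 2) :
    k = k' ∧ a = a' ∧ b = b' := by
  obtain ⟨M, hM⟩ : ∃ M : ℤ, M = 8 * (n + 1) := ⟨_, rfl⟩
  have hMpos : 0 < M := by omega
  have hMq : (M : ℚ) ≠ 0 := by exact_mod_cast hMpos.ne'
  have he : eps n = 1 / (M : ℚ) := by rw [hM, eps]; push_cast; rfl
  rw [he] at h
  field_simp at h
  have hz : (k - k') * M ^ 2 + (a - a') * M + (b - b') = 0 := by
    have : k * M ^ 2 + a * M + b = k' * M ^ 2 + a' * M + b' := by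
      have h' : (k : ℚ) * M ^ 2 + a * M + b = k' * M ^ 2 + a' * M + b' := by linarith
      exact_mod_cast h'
    linarith
  have hbb : b - b' = 0 := by
    refine Int.eq_zero_of_abs_lt_dvd (m := M) ⟨-((k - k') * M + (a - a')), by linarith⟩ ?_
    rw [abs_lt]
    omega
  have hz' : ((k - k') * M + (a - a')) * M = 0 := by rw [hbb] at hz; linarith
  have hz' := (mul_eq_zero.1 hz').resolve_right hMpos.ne'
  have haa : a - a' = 0 := by
    refine Int.eq_zero_of_abs_lt_dvd (m := M) ⟨-(k - k'), by linarith⟩ ?_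
    rw [abs_le] at ha ha'
    rw [abs_lt]
    omega
  rw [haa, add_zero] at hz'
  have hkk := (mul_eq_zero.1 hz').resolve_right hMpos.ne'
  omega

/-- The digits identify `v`: for `a = ±3` the integer part belongs to the boundary point, but the
last digit is the second coordinate of `v`; otherwise the integer part is the first coordinate of
`v`. -/
theorem Placed.expansion {v p : Pt} {a : ℤ} (h : Placed π v a p) (hv : v ∈ inputPoints π) :
    ∃ k b : ℤ, p.1 = k + a * eps n + b * eps n ^ 2 ∧ |a| ≤ 3 ∧ 0 ≤ b ∧ b ≤ n ∧
      (if |a| = 3 then v.2 = b else v.1 = k) := by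
  obtain ⟨x, y, hxy, h1, h2, h3, h4⟩ := exists_nat_coords hv
  have hx : v.1 = ((x : ℤ) : ℚ) := by rw [hxy]; simp
  have hy : v.2 = ((y : ℤ) : ℚ) := by rw [hxy]; simp
  cases h with
  | self => exact ⟨x, 0, by rw [hx]; simp, by norm_num, le_rfl, by omega, by simpa using hx⟩
  | right => exact ⟨x, 0, by rw [hx]; simp, by norm_num, le_rfl, by omega, by simpa using hx⟩
  | left =>
    exact ⟨x, 0, by rw [hx]; push_cast; ring, by norm_num, le_rfl, by omega, by simpa using hx⟩
  | bfirst =>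
    exact ⟨x, 0, by rw [hx]; push_cast; ring, by norm_num, le_rfl, by omega, by simpa using hx⟩
  | tlast =>
    exact ⟨x, 0, by rw [hx]; push_cast; ring, by norm_num, le_rfl, by omega, by simpa using hx⟩
  | blast c hc =>
    obtain ⟨k, l, hkl, -⟩ := exists_nat_coords hc
    refine ⟨k, y, ?_, by norm_num, by omega, by omega, by simpa using hy⟩
    rw [hy, hkl]
    push_cast
    ring
  | tfirst c hc =>
    obtain ⟨k, l, hkl, -⟩ := exists_nat_coords hc
    refine ⟨k, y, ?_, by norm_num, by omega, by omega, by simpa using hy⟩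
    rw [hy, hkl]
    push_cast
    ring

/-- The coefficient determines the kind of point, and the equation stored in an auxiliary case
determines `c`. -/
theorem Placed.unique {v p q : Pt} {a : ℤ} (hp : Placed π v a p) (hq : Placed π v a q)  :
    p = q := by
  cases hp <;> cases hq <;> simp_all

theorem augmented_injOn : ∀ p ∈ augmented π, ∀ q ∈ augmented π, p.1 = q.1 → p = q := by
  intro p hp q hq hpq
  obtain ⟨v, hv, a, ha⟩ := exists_placed hp
  obtain ⟨w, hw, a', ha'⟩ := exists_placed hq
  obtain ⟨k, b, h1, h2, h3, h4, h5⟩ := ha.expansion hv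
  obtain ⟨k', b', h1', h2', h3', h4', h5'⟩ := ha'.expansion hw
  rw [h1, h1'] at hpq
  obtain ⟨rfl, rfl, rfl⟩ := eps_expansion_unique h2 h2' h3 h4 h3' h4' hpq
  have hvw : v = w := by
    split_ifs at h5 h5'
    · exact input_eq_of_snd hv hw (h5.trans h5'.symm)
    · exact input_eq_of_fst hv hw (h5.trans h5'.symm)
  subst hvw
  exact ha.unique ha'

end Placement

/-! ### The augmentation preserves distances. -/

section Isometry

variable {n : ℕ} {π : Equiv.Perm (Fin n)}

/-- The integer nearest to `x`. -/
def nearest (x : ℚ) : ℤ := ⌊x + 1 / 2⌋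

theorem nearest_mono : Monotone nearest := fun _ _ h => Int.floor_mono (by linarith)

theorem nearest_fst {v : Pt} (hv : v ∈ inputPoints π) {x : ℚ} (h1 : v.1 - 1 / 2 ≤ x)
    (h2 : x < v.1 + 1 / 2) : (nearest x : ℚ) = v.1 := by
  obtain ⟨a, b, rfl, -⟩ := exists_nat_coords hv
  have : nearest x = (a : ℤ) := by
    rw [nearest, Int.floor_eq_iff]
    push_cast
    dsimp only at h1 h2
    constructor <;> linarith
  rw [this]
  simp

theorem nearest_snd {v : Pt} (hv : v ∈ inputPoints π) {x : ℚ} (h1 : v.2 - 1 / 2 ≤ x)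
    (h2 : x < v.2 + 1 / 2) : (nearest x : ℚ) = v.2 := by
  obtain ⟨a, b, rfl, -⟩ := exists_nat_coords hv
  have : nearest x = (b : ℤ) := by
    rw [nearest, Int.floor_eq_iff]
    push_cast
    dsimp only at h1 h2
    constructor <;> linarith
  rw [this]
  simp

theorem nearest_gridPoint_fst (i : Fin n) : (nearest (gridPoint π i).1 : ℚ) = (gridPoint π i).1 :=
  nearest_fst (gridPoint_mem i) (by linarith) (by linarith)

theorem nearest_gridPoint_snd (i : Fin n) : (nearest (gridPoint π i).2 : ℚ) = (gridPoint π i).2 :=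
  nearest_snd (gridPoint_mem i) (by linarith) (by linarith)

/-- Every point of the augmented set is, up to rounding, dominated by input points in the directions
of both boundaries. -/
theorem exists_dominating {p : Pt} (hp : p ∈ augmented π) :
    (∃ q ∈ inputPoints π, (nearest p.1 : ℚ) ≤ q.1 ∧ q.2 ≤ nearest p.2) ∧
      ∃ q ∈ inputPoints π, q.1 ≤ nearest p.1 ∧ (nearest p.2 : ℚ) ≤ q.2 := by
  obtain ⟨v, hv, a, h⟩ := exists_placed hp
  have he := eps_pos n
  have he' := eps_le (one_le_of_mem hv)
  obtain ⟨h1, h2, h3, h4⟩ := input_bounds hv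
  have h5 := mul_eps_sq_le h2
  have h6 := mul_eps_sq_le h4
  have h7 : 0 ≤ v.1 * eps n ^ 2 := by positivity
  have h8 : 0 ≤ v.2 * eps n ^ 2 := by positivity
  suffices ∃ x ∈ inputPoints π, ∃ y ∈ inputPoints π,
      x.1 - 1 / 2 ≤ p.1 ∧ p.1 < x.1 + 1 / 2 ∧ y.2 - 1 / 2 ≤ p.2 ∧ p.2 < y.2 + 1 / 2 ∧
      (∃ q ∈ inputPoints π, x.1 ≤ q.1 ∧ q.2 ≤ y.2) ∧
        ∃ q ∈ inputPoints π, q.1 ≤ x.1 ∧ y.2 ≤ q.2 by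
    obtain ⟨x, hx, y, hy, hx1, hx2, hy1, hy2, H⟩ := this
    rwa [nearest_fst hx hx1 hx2, nearest_snd hy hy1 hy2]
  cases h with
  | self => exact ⟨p, hv, p, hv, by linarith, by linarith, by linarith, by linarith,
      ⟨p, hv, le_rfl, le_rfl⟩, ⟨p, hv, le_rfl, le_rfl⟩⟩
  | right | left =>
    refine ⟨v, hv, v, hv, ?_, ?_, ?_, ?_, ⟨v, hv, le_rfl, le_rfl⟩, ⟨v, hv, le_rfl, le_rfl⟩⟩ <;>
      dsimp only <;> linarith
  | bfirst c hc hc1 hc2 =>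
    refine ⟨v, hv, c, hc, ?_, ?_, ?_, ?_, ⟨c, hc, hc1, le_rfl⟩, ⟨v, hv, le_rfl, hc2⟩⟩ <;>
      dsimp only <;> linarith
  | blast c hc hc1 hc2 =>
    refine ⟨c, hc, v, hv, ?_, ?_, ?_, ?_, ⟨c, hc, le_rfl, hc2⟩, ⟨v, hv, hc1, le_rfl⟩⟩ <;>
      dsimp only <;> linarith
  | tfirst c hc hc1 hc2 =>
    refine ⟨c, hc, v, hv, ?_, ?_, ?_, ?_, ⟨v, hv, hc1, le_rfl⟩, ⟨c, hc, le_rfl, hc2⟩⟩ <;>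
      dsimp only <;> linarith
  | tlast c hc hc1 hc2 =>
    refine ⟨v, hv, c, hc, ?_, ?_, ?_, ?_, ⟨v, hv, le_rfl, hc2⟩, ⟨c, hc, hc1, le_rfl⟩⟩ <;>
      dsimp only <;> linarith

theorem input_mem_augmented {v : Pt} (hv : v ∈ inputPoints π) : v ∈ augmented π :=
  Finset.mem_union_left _ (input_mem_stageOne hv)

/-- The permutation graph is an induced subgraph of the graph of the augmented set. -/
def gridHom (π : Equiv.Perm (Fin n)) : permGraph π →g ptGraph (augmented π) where
  toFun := gridPoint π
  map_rel' h := ⟨input_mem_augmented (gridPoint_mem _), input_mem_augmented (gridPoint_mem _),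
    permGraph_adj_iff.1 h⟩

theorem dist_le_dist_add_one (hc : (permGraph π).Connected) {u i j : Fin n}
    (h : (permGraph π).Adj i j) :
    (permGraph π).dist u j ≤ (permGraph π).dist u i + 1 := by
  rw [← SimpleGraph.dist_eq_one_iff_adj.2 h]
  exact hc.dist_triangle

/-- Along an edge, the coordinate that is smaller at `p` inherits its witness, as rounding is
monotone. For the other one, take the input point dominating `p` in that direction: either the
witness for the first coordinate is also far enough in the other, or it is adjacent to this
dominating point. -/
theorem exists_near_input (hc : (permGraph π).Connected) {x p : Pt} {u : Fin n}
    (hx : gridPoint π u = x) (w : (ptGraph (augmented π)).Walk p x) :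
    (∃ q, (permGraph π).dist u q ≤ w.length ∧ (nearest p.1 : ℚ) ≤ (gridPoint π q).1) ∧
      ∃ q, (permGraph π).dist u q ≤ w.length ∧ (nearest p.2 : ℚ) ≤ (gridPoint π q).2 := by
  induction w with
  | nil =>
    subst hx
    refine ⟨⟨u, by simp, ?_⟩, ⟨u, by simp, ?_⟩⟩
    · rw [nearest_gridPoint_fst]
    · rw [nearest_gridPoint_snd]
  | @cons p p' _ h w ih =>
    obtain ⟨⟨a, ha1, ha2⟩, b, hb1, hb2⟩ := ih hx
    simp only [SimpleGraph.Walk.length_cons]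
    obtain ⟨⟨c, hcm, hc1, hc2⟩, d, hdm, hd1, hd2⟩ := exists_dominating h.1
    obtain ⟨c, rfl⟩ := exists_gridPoint hcm
    obtain ⟨d, rfl⟩ := exists_gridPoint hdm
    rcases h.2.2 with ⟨h1, h2⟩ | ⟨h1, h2⟩
    · have h1' : (nearest p'.1 : ℚ) ≤ nearest p.1 := Int.cast_le.2 (nearest_mono h1.le)
      have h2' : (nearest p.2 : ℚ) ≤ nearest p'.2 := Int.cast_le.2 (nearest_mono h2.le)
      refine ⟨?_, b, by omega, h2'.trans hb2⟩
      by_cases hcb : (gridPoint π c).1 ≤ (gridPoint π b).1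
      · exact ⟨b, by omega, hc1.trans hcb⟩
      · have := dist_le_dist_add_one hc (u := u)
          (permGraph_adj_of_lt_fst (not_le.1 hcb) (hc2.trans (h2'.trans hb2)))
        exact ⟨c, by omega, hc1⟩
    · have h1' : (nearest p.1 : ℚ) ≤ nearest p'.1 := Int.cast_le.2 (nearest_mono h1.le)
      refine ⟨⟨a, by omega, h1'.trans ha2⟩, ?_⟩
      by_cases hda : (gridPoint π d).2 ≤ (gridPoint π a).2
      · exact ⟨a, by omega, hd2.trans hda⟩
      · have := dist_le_dist_add_one hc (u := u)
          (permGraph_adj_of_lt_snd (hd1.trans (h1'.trans ha2)) (not_le.1 hda)).symm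
        exact ⟨d, by omega, hd2⟩

/-- The first vertex `b` of the walk that is not below `v` cannot be above `v` either, since
adjacent points are incomparable. So `b` is adjacent to `v`, and at least one more step is needed to
get from `b` to `q`. -/
theorem dist_le_length_of_le (hc : (permGraph π).Connected) {v : Fin n} {a q : Fin n}
    (w : (permGraph π).Walk a q) (ha : gridPoint π a ≤ gridPoint π v)
    (hq : gridPoint π v ≤ gridPoint π q) : (permGraph π).dist a v ≤ w.length := by
  induction w with
  | nil => simp [gridPoint_injective (ha.antisymm hq)]
  | @cons a b q h w ih =>
    rw [SimpleGraph.Walk.length_cons]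
    have h1 := SimpleGraph.dist_eq_one_iff_adj.2 h
    have h2 := hc.dist_triangle (u := a) (v := b) (w := v)
    by_cases hb : gridPoint π b ≤ gridPoint π v
    · have := ih hb hq
      omega
    have hvb : ¬ gridPoint π v ≤ gridPoint π b := by
      intro hvb
      have hab := ha.trans hvb
      rcases permGraph_adj_iff.1 h with h | h
      · exact h.1.not_ge hab.1
      · exact h.2.not_ge hab.2
    have hadj : (permGraph π).Adj b v := by
      rw [Prod.le_def, not_and_or, not_le, not_le] at hb hvb
      refine permGraph_adj_iff.2 ?_
      rcases hb with hb | hb <;> rcases hvb with hvb | hvb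
      · exact absurd hb hvb.not_gt
      · exact Or.inl ⟨hb, hvb⟩
      · exact Or.inr ⟨hvb, hb⟩
      · exact absurd hb hvb.not_gt
    have h3 := SimpleGraph.dist_eq_one_iff_adj.2 hadj
    have h4 : w.length ≠ 0 := by
      intro h0
      rw [SimpleGraph.Walk.eq_of_length_eq_zero h0] at hvb
      exact hvb hq
    omega

/-- The point next to `v` exceeds `v` in one coordinate, so the input point found near it is at
least `v` in that coordinate. It is either adjacent to `v` or above `v`; in the latter case a
shortest walk to it from `u` has to pass `v`. -/
theorem dist_le_length_of_augmented (hc : (permGraph π).Connected) {u v : Fin n}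
    (huv : gridPoint π u ≤ gridPoint π v)
    (w : (ptGraph (augmented π)).Walk (gridPoint π v) (gridPoint π u)) :
    (permGraph π).dist u v ≤ w.length := by
  generalize hx : gridPoint π u = x at w
  generalize hy : gridPoint π v = y at w
  cases w with
  | nil => simp [gridPoint_injective (hx.trans hy.symm)]
  | @cons _ p _ h w =>
    rw [SimpleGraph.Walk.length_cons]
    subst hy
    obtain ⟨⟨a, ha1, ha2⟩, b, hb1, hb2⟩ := exists_near_input hc hx w
    have key : ∀ q, (permGraph π).dist u q ≤ w.length →
        (permGraph π).Adj q v ∨ gridPoint π v ≤ gridPoint π q →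
        (permGraph π).dist u v ≤ w.length + 1 := by
      rintro q hq (hqv | hvq)
      · have := dist_le_dist_add_one hc (u := u) hqv
        omega
      · obtain ⟨w', hw'⟩ := hc.exists_walk_length_eq_dist u q
        have := dist_le_length_of_le hc w' huv hvq
        omega
    rcases h.2.2 with h | h
    · have hvb : (gridPoint π v).2 ≤ (gridPoint π b).2 := by
        rw [← nearest_gridPoint_snd]
        exact (Int.cast_le.2 (nearest_mono h.2.le)).trans hb2
      refine key b hb1 ?_
      by_cases hb : (gridPoint π v).1 ≤ (gridPoint π b).1
      · exact Or.inr ⟨hb, hvb⟩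
      · exact Or.inl (permGraph_adj_of_lt_fst (not_le.1 hb) hvb)
    · have hva : (gridPoint π v).1 ≤ (gridPoint π a).1 := by
        rw [← nearest_gridPoint_fst]
        exact (Int.cast_le.2 (nearest_mono h.1.le)).trans ha2
      refine key a ha1 ?_
      by_cases ha : (gridPoint π v).2 ≤ (gridPoint π a).2
      · exact Or.inr ⟨hva, ha⟩
      · exact Or.inl (permGraph_adj_of_lt_snd hva (not_le.1 ha)).symm

theorem reachable_gridPoint (hc : (permGraph π).Connected) (u v : Fin n) :
    (ptGraph (augmented π)).Reachable (gridPoint π u) (gridPoint π v) :=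
  (hc u v).map (gridHom π)

/-- The augmentation does not change distances of input points. -/
theorem dist_augmented (hc : (permGraph π).Connected) (u v : Fin n) :
    (ptGraph (augmented π)).dist (gridPoint π u) (gridPoint π v) = (permGraph π).dist u v := by
  refine le_antisymm ?_ ?_
  · obtain ⟨w, hw⟩ := hc.exists_walk_length_eq_dist u v
    rw [← hw, ← w.length_map (gridHom π)]
    exact SimpleGraph.dist_le _
  · have hr := reachable_gridPoint hc u v
    by_cases huv : gridPoint π u ≤ gridPoint π v
    · obtain ⟨w, hw⟩ := hr.symm.exists_walk_length_eq_dist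
      rw [SimpleGraph.dist_comm (G := ptGraph _), ← hw]
      exact dist_le_length_of_augmented hc huv w
    by_cases hvu : gridPoint π v ≤ gridPoint π u
    · obtain ⟨w, hw⟩ := hr.exists_walk_length_eq_dist
      rw [SimpleGraph.dist_comm (G := permGraph π), ← hw]
      exact dist_le_length_of_augmented hc hvu w
    · have hne : u ≠ v := by
        rintro rfl
        exact huv le_rfl
      have h1 : (permGraph π).Adj u v := by
        rw [Prod.le_def, not_and_or, not_le, not_le] at huv hvu
        refine permGraph_adj_iff.2 ?_
        rcases huv with h | h <;> rcases hvu with h' | h'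
        · exact absurd h h'.not_gt
        · exact Or.inl ⟨h, h'⟩
        · exact Or.inr ⟨h', h⟩
        · exact absurd h h'.not_gt
      rw [SimpleGraph.dist_eq_one_iff_adj.2 h1]
      exact hr.pos_dist_of_ne (gridPoint_injective.ne hne)

end Isometry

/-! ### Layer bounds, labels and the decoder. -/

section Labels

variable {n : ℕ} {π : Equiv.Perm (Fin n)}

/-- The point added below and to the right of the lowest input point `w` is adjacent to the leftmost
point. -/
theorem exists_lowest (π : Equiv.Perm (Fin n)) (hn : 1 ≤ n) : ∃ w : Fin n,
    (gridPoint π w).2 = 1 ∧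
    ((gridPoint π w).1 + 2 * eps n, (gridPoint π w).2 - 2 * eps n) ∈ augmented π ∧
    InBR (first (augmented π)) ((gridPoint π w).1 + 2 * eps n, (gridPoint π w).2 - 2 * eps n) := by
  have he := eps_pos n
  have he' := eps_le hn
  have hw : (gridPoint π (π ⟨0, hn⟩)).2 = 1 := by simp [gridPoint]
  have hx : (gridPoint π ⟨0, hn⟩).1 = 1 := by simp [gridPoint]
  have hwS : ((gridPoint π (π ⟨0, hn⟩)).1 + 2 * eps n, (gridPoint π (π ⟨0, hn⟩)).2 - 2 * eps n) ∈
      augmented π := by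
    refine Finset.mem_union_left _ (Finset.mem_union_left _ (Finset.mem_union_right _
      (Finset.mem_image.2 ⟨_, Finset.mem_filter.2 ⟨gridPoint_mem _, fun q hq h => ?_⟩, rfl⟩)))
    exact (h.2.trans_le (hw.le.trans (input_bounds hq).2.2.1)).false
  have hxS : ((gridPoint π ⟨0, hn⟩).1 - 2 * eps n, (gridPoint π ⟨0, hn⟩).2 + 2 * eps n) ∈
      augmented π := by
    refine Finset.mem_union_left _ (Finset.mem_union_right _
      (Finset.mem_image.2 ⟨_, Finset.mem_filter.2 ⟨gridPoint_mem _, fun q hq h => ?_⟩, rfl⟩))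
    exact (h.1.trans_le (hx.le.trans (input_bounds hq).1)).false
  refine ⟨_, hw, hwS, ?_⟩
  obtain ⟨hs, hmin⟩ := first_spec ⟨_, hwS⟩
  have hs1 := hmin _ hxS
  rw [hx] at hs1
  dsimp only at hs1
  have hw1 := (input_bounds (gridPoint_mem (π := π) (π ⟨0, hn⟩))).1
  refine ⟨by dsimp only; linarith, ?_⟩
  rw [hw]
  -- By `hs1` the leftmost point has first coordinate at most `1 - 2ε`, which leaves only the kinds
  -- `left` and `tfirst`; their second coordinates are at least `1 - ε`.
  obtain ⟨v, hv, a, h⟩ := exists_placed hs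
  generalize first (augmented π) = s at *
  have hv' := input_bounds hv
  have h8 : 0 ≤ v.2 * eps n ^ 2 := mul_nonneg (by linarith) (by positivity)
  cases h with
  | self => dsimp only at *; linarith
  | right => dsimp only at *; linarith
  | left => dsimp only at *; linarith
  | bfirst => dsimp only at *; linarith
  | blast c hc => have := input_bounds hc; dsimp only at *; linarith
  | tfirst => dsimp only at *; linarith
  | tlast => dsimp only at *; linarith

theorem isLeftEnd_augmented (hn : 1 ≤ n) : IsLeftEnd (augmented π) (first (augmented π)) := by
  obtain ⟨w, -, hw, h⟩ := exists_lowest π hn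
  have := first_spec ⟨_, hw⟩
  exact ⟨this.1, this.2, augmented_injOn, _, hw, h⟩

theorem eq_of_inBR_of_one {π : Equiv.Perm (Fin 1)} {w : Fin 1} {p : Pt} (hp : p ∈ augmented π)
    (h : InBR (gridPoint π w) p) :
    p = ((gridPoint π w).1 + 2 * eps 1, (gridPoint π w).2 - 2 * eps 1) := by
  obtain ⟨v, hv, a, h'⟩ := exists_placed hp
  have he := eps_pos 1
  obtain ⟨i, rfl⟩ := exists_gridPoint hv
  rw [Subsingleton.elim i w] at h' hv
  have hv' := input_bounds hv
  have h7 : 0 ≤ (gridPoint π w).1 * eps 1 ^ 2 := mul_nonneg (by linarith) (by positivity)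
  obtain ⟨h1, h2⟩ := h
  cases h' with
  | self => exact absurd h1 (lt_irrefl _)
  | right => rfl
  | left => dsimp only at *; linarith
  | bfirst => dsimp only at *; linarith
  | blast => dsimp only at *; linarith
  | tfirst c hc hc1 hc2 =>
    obtain ⟨j, rfl⟩ := exists_gridPoint hc
    have h8 := mul_eps_sq_le hv'.2.2.2
    dsimp only at *
    linarith
  | tlast c hc hc1 hc2 => dsimp only at *; linarith

/-- The lowered copy `w'` of the lowest input point `w` is adjacent to the leftmost point and to
every input neighbour of `w`. It can therefore replace `w` on a shortest path from `w` to `v`, which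
has at most `n - 1` edges; the edges at the leftmost point and at `p` bring the bound to `n + 1`. -/
theorem dist_first_le (hc : (permGraph π).Connected) {v : Fin n} {p : Pt} (hp : p ∈ augmented π)
    (h : (ptGraph (augmented π)).Adj (gridPoint π v) p) :
    (ptGraph (augmented π)).dist (first (augmented π)) p ≤ n + 1 ∧
      (ptGraph (augmented π)).Reachable (first (augmented π)) (gridPoint π v) := by
  have hn : 1 ≤ n := v.pos
  have he := eps_pos n
  obtain ⟨w, hw1, hw, hs⟩ := exists_lowest π hn
  obtain ⟨hsS, -⟩ := first_spec ⟨_, hw⟩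
  set s := first (augmented π)
  set w' : Pt := ((gridPoint π w).1 + 2 * eps n, (gridPoint π w).2 - 2 * eps n) with hw'
  have hsw : (ptGraph (augmented π)).Adj s w' := ⟨hsS, hw, Or.inr hs⟩
  by_cases hvw : v = w
  · subst hvw
    have hwv : (ptGraph (augmented π)).Adj w' (gridPoint π v) :=
      ⟨hw, input_mem_augmented (gridPoint_mem v), Or.inl
        ⟨by simp only [hw']; linarith, by simp only [hw']; linarith⟩⟩
    refine ⟨?_, hsw.reachable.trans hwv.reachable⟩
    rcases h.2.2 with h' | h'
    · have hwp : (ptGraph (augmented π)).Adj w' p :=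
        ⟨hw, hp, Or.inl ⟨h'.1.trans (by simp only [hw']; linarith),
          lt_trans (by simp only [hw']; linarith) h'.2⟩⟩
      have := SimpleGraph.dist_le (.cons hsw (.cons hwp .nil))
      simp only [SimpleGraph.Walk.length_cons, SimpleGraph.Walk.length_nil] at this
      omega
    -- The route through `w'` and `w` has length 3, which exceeds `n + 1` exactly when `n = 1`; in
    -- that case `p` is `w'` itself.
    · obtain rfl | hn2 := hn.eq_or_lt
      · rw [eq_of_inBR_of_one hp h']
        have := SimpleGraph.dist_le hsw.toWalk
        simp only [SimpleGraph.Walk.length_cons, SimpleGraph.Walk.length_nil] at this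
        exact this.trans (by omega)
      · have := SimpleGraph.dist_le (.cons hsw (.cons hwv (.cons h .nil)))
        simp only [SimpleGraph.Walk.length_cons, SimpleGraph.Walk.length_nil] at this
        omega
  · obtain ⟨P, hP, -⟩ := hc.exists_path_of_dist w v
    have hlen := hP.length_lt
    rw [Fintype.card_fin] at hlen
    cases P with
    | nil => exact absurd rfl hvw
    | @cons _ a _ hwa P =>
      have hwa' : (ptGraph (augmented π)).Adj w' (gridPoint π a) := by
        refine ⟨hw, input_mem_augmented (gridPoint_mem a), Or.inl ?_⟩
        have ha := (input_bounds (gridPoint_mem (π := π) a)).2.2.1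
        rcases permGraph_adj_iff.1 hwa with h | h
        · exact ⟨h.1.trans (by simp only [hw']; linarith),
            lt_trans (by simp only [hw']; linarith) h.2⟩
        · have := h.2
          linarith
      obtain ⟨Q, hQ⟩ : ∃ Q : (ptGraph (augmented π)).Walk (gridPoint π a) (gridPoint π v),
          Q.length = P.length := ⟨P.map (gridHom π), P.length_map _⟩
      refine ⟨?_, ⟨.cons hsw (.cons hwa' Q)⟩⟩
      have := SimpleGraph.dist_le (.cons hsw (.cons hwa' (Q.concat h)))
      simp only [SimpleGraph.Walk.length_cons, SimpleGraph.Walk.length_concat] at this hlen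
      omega

/-- The layer of the coordinate of index `m` of the labelled element. -/
def Label.level (l : Label) (m : ℕ) : ℕ := if m % 2 = 1 then l.lBfirst else l.lTfirst

/-- The rank of the coordinate of index `m` of the labelled element. -/
def Label.rank (l : Label) (m : ℕ) : ℕ := if m % 2 = 1 then l.x' else l.y'

/-- Some value reached in `k` steps from a coordinate of the first element exceeds the corresponding
coordinate of the second element. -/
def Reaches (a b : Label) (k : ℕ) : Prop :=
  ∃ m, b.level (m + k) < a.level m + k ∨
    (a.level m + k = b.level (m + k) ∧ b.rank (m + k) < a.rank m)

open Classical in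
/-- The distance of two elements in terms of their labels. -/
noncomputable def labelDist (a b : Label) : ℕ :=
  if Reaches b a 0 then 1 + sInf {k | Reaches a b k} else 1 + sInf {k | Reaches b a k}

/-- The label of `v` with given integers. -/
noncomputable def labelOf (π : Equiv.Perm (Fin n)) (x' y' : Fin n → ℕ) (v : Fin n) : Label :=
  ⟨x' v, y' v, false, false, layerBfirst π v, layerBlast π v, layerTfirst π v, layerTlast π v⟩

theorem augmented_quadrants (v : Fin n) :
    (∃ q ∈ augmented π, InTL (gridPoint π v) q) ∧ ∃ q ∈ augmented π, InBR (gridPoint π v) q := by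
  obtain ⟨⟨p, hp, h⟩, q, hq, h'⟩ := exists_quadrants π (gridPoint_mem v)
  exact ⟨⟨q, Finset.mem_union_left _ hq, h'⟩, p, Finset.mem_union_left _ hp, h⟩

theorem reachable_first (hc : (permGraph π).Connected) (v : Fin n) :
    (ptGraph (augmented π)).Reachable (first (augmented π)) (gridPoint π v) := by
  obtain ⟨⟨q, hq, h⟩, -⟩ := augmented_quadrants (π := π) v
  exact (dist_first_le hc hq ⟨input_mem_augmented (gridPoint_mem v), hq, Or.inl h⟩).2

theorem isLayer_level (hc : (permGraph π).Connected) (x' y' : Fin n → ℕ) (v : Fin n) (m : ℕ) :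
    (labelOf π x' y' v).level m % 2 = m % 2 ∧
      IsLayer (augmented π) (first (augmented π)) (gridPoint π v)
        ((labelOf π x' y' v).level m) := by
  have hs := isLeftEnd_augmented (π := π) v.pos
  have hv := input_mem_augmented (gridPoint_mem (π := π) v)
  obtain ⟨-, hB, hT⟩ := nbrs_nonempty π (gridPoint_mem v)
  rcases Nat.mod_two_eq_zero_or_one m with h | h
  · simpa [Label.level, h, labelOf, layerTfirst, layer] using
      hs.isLayer_Tfirst hv hT (reachable_first hc v)
  · simpa [Label.level, h, labelOf, layerBfirst, layer] using
      hs.isLayer_Bfirst hv hB (reachable_first hc v)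

/-- Integers can be chosen such that the labels determine the values reached by the elements. -/
theorem exists_ranks (hc : (permGraph π).Connected) : ∃ x' y' : Fin n → ℕ,
    (∀ v, x' v ≤ 2 * n ∧ y' v ≤ 2 * n) ∧ ∀ u v k,
      (∃ m, (coord (m + k) (gridPoint π v) : WithBot ℚ) <
        climb (reach (augmented π)) m k (coord m (gridPoint π u) : WithBot ℚ)) ↔
      Reaches (labelOf π x' y' u) (labelOf π x' y' v) k := by
  let lev : Fin n × Bool → ℕ := fun i => if i.2 then layerBfirst π i.1 else layerTfirst π i.1
  -- Both coordinates are ranked together, since an odd number of steps compares a first coordinate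
  -- with a second one.
  obtain ⟨r, hr, hlt⟩ := exists_rank (reach_mono (augmented π))
    fun i : Fin n × Bool => (lev i, (coord (lev i) (gridPoint π i.1) : WithBot ℚ))
  have hcard : Fintype.card (Fin n × Bool) = 2 * n := by simp [mul_comm]
  rw [hcard] at hr
  refine ⟨fun v => r (v, true), fun v => r (v, false), fun v => ⟨hr _, hr _⟩, fun u v k =>
    exists_congr fun m => ?_⟩
  set x' := fun v => r (v, true)
  set y' := fun v => r (v, false)
  have hlev : ∀ v m, (labelOf π x' y' v).level m = lev (v, decide (m % 2 = 1)) := by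
    intro v m
    by_cases h : m % 2 = 1 <;> simp [Label.level, lev, labelOf, h]
  have hrank : ∀ v m, (labelOf π x' y' v).rank m = r (v, decide (m % 2 = 1)) := by
    intro v m
    by_cases h : m % 2 = 1 <;> simp [Label.rank, x', y', labelOf, h]
  have hs := isLeftEnd_augmented (π := π) v.pos
  obtain ⟨hTL, hBR⟩ := augmented_quadrants (π := π) u
  obtain ⟨hu1, hu2⟩ := isLayer_level hc x' y' u m
  obtain ⟨hv1, hv2⟩ := isLayer_level hc x' y' v (m + k)
  rw [← coord_congr hv1, ← climb_reach_congr _ hu1, ← coord_congr hu1,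
    hs.lt_climb_iff hTL hBR hu2 hv2 (by omega), hrank, hrank, hlt, ← hlev, ← hlev]

theorem not_le_iff_exists_coord {p q : Pt} : ¬ p ≤ q ↔ ∃ m, coord m q < coord m p := by
  refine ⟨fun h => ?_, fun ⟨m, hm⟩ h => (coord_mono h m).not_gt hm⟩
  rw [Prod.le_def, not_and_or, not_le, not_le] at h
  exact h.elim (fun h => ⟨1, h⟩) fun h => ⟨0, h⟩

end Labels

end PermDist

theorem mainTheorem2 :
    ∃ (C : ℕ) (D : PermDist.Label → PermDist.Label → ℕ),
      ∀ (n : ℕ) (π : Equiv.Perm (Fin n)), (PermDist.permGraph π).Connected →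
        (∀ v : Fin n,
          PermDist.layerBfirst π v ≤ n + 1 ∧ PermDist.layerBlast π v ≤ n + 1 ∧
          PermDist.layerTfirst π v ≤ n + 1 ∧ PermDist.layerTlast π v ≤ n + 1) ∧
        ∃ (x' y' : Fin n → ℕ) (binf tinf : Fin n → Bool),
          (∀ v : Fin n, x' v ≤ C * n ∧ y' v ≤ C * n) ∧
          ∀ u v : Fin n, u ≠ v →
            D ⟨x' u, y' u, binf u, tinf u, PermDist.layerBfirst π u, PermDist.layerBlast π u,
                PermDist.layerTfirst π u, PermDist.layerTlast π u⟩
              ⟨x' v, y' v, binf v, tinf v, PermDist.layerBfirst π v, PermDist.layerBlast π v,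
                PermDist.layerTfirst π v, PermDist.layerTlast π v⟩ =
              (PermDist.permGraph π).dist u v := by
  open PermDist in
  refine ⟨2, labelDist, fun n π hc => ⟨fun v => ?_, ?_⟩⟩
  · obtain ⟨-, hB, hT⟩ := nbrs_nonempty π (gridPoint_mem v)
    have hv := input_mem_augmented (gridPoint_mem (π := π) v)
    have key : ∀ p, p ∈ bottomNbrs (augmented π) (gridPoint π v) ∨
        p ∈ topNbrs (augmented π) (gridPoint π v) → layer (augmented π) p ≤ n + 1 := by
      rintro p (hp | hp) <;>
      · obtain ⟨hp1, hp2⟩ := Finset.mem_filter.1 hp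
        have hp3 := (Finset.mem_filter.1 hp1).1
        exact (dist_first_le hc hp3 ⟨hv, hp3, hp2⟩).1
    exact ⟨key _ (Or.inl (first_spec hB).1), key _ (Or.inl (last_spec hB).1),
      key _ (Or.inr (first_spec hT).1), key _ (Or.inr (last_spec hT).1)⟩
  · obtain ⟨x', y', hb, H⟩ := exists_ranks hc
    refine ⟨x', y', fun _ => false, fun _ => false, hb, fun u v huv => ?_⟩
    change labelDist (labelOf π x' y' u) (labelOf π x' y' v) = _
    have hu := input_mem_augmented (gridPoint_mem (π := π) u)
    have hv := input_mem_augmented (gridPoint_mem (π := π) v)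
    -- Without any step, `Reaches` is a plain comparison of coordinates. It tells the decoder from
    -- which of the two points `dist_eq` may start.
    have h0 : Reaches (labelOf π x' y' v) (labelOf π x' y' u) 0 ↔
        ¬ gridPoint π v ≤ gridPoint π u := by
      rw [← H, not_le_iff_exists_coord]
      exact exists_congr fun m => WithBot.coe_lt_coe
    rw [labelDist, h0, ← dist_augmented hc]
    simp only [← H]
    split_ifs with h
    · rw [SimpleGraph.dist_comm]
      exact (dist_eq hv hu (fun h' => huv (gridPoint_injective (h'.antisymm h)))
        (reachable_gridPoint hc v u)).symm
    · exact (dist_eq hu hv h (reachable_gridPoint hc u v)).symm
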